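/- Let $\kappa$ be an algebraically closed field of characteristic $p>3$, and let $\mathfrak g=\mathfrak g_0\oplus\mathfrak g_1$ be a finite-dimensional Lie superalgebra over $\kappa$ with universal enveloping algebra $U(\mathfrak g)$. Let $x_1,\dots,x_s$ be a basis of $\mathfrak g_1$ such that, for some $0\le s_1\le s$, $[x_i,x_i]=0$ for $i\le s_1$ and $z_j:=[x_j,x_j]\neq 0$ for $s_1<j\le s$. Assume that $z_{s_1+1},\dots,z_s$ are linearly independent and let $V\subseteq\mathfrak g_0$ be the subspace spanned by them. Let $W$ be a subspace of $\mathfrak g_0$ with $\mathfrak g_0=W\oplus V$, and let $y_1,\dots,y_{t_1}$ be a basis of $W$. Then: (1) $U(\mathfrak g)$ has a $\kappa$-basis consisting of the elements $$x_1^{a_1}\cdots x_{s_1}^{a_{s_1}}\,x_{s_1+1}^{b_1}\cdots x_s^{b_{s-s_1}}\,y_1^{c_1}\cdots y_{t_1}^{c_{t_1}},\qquad 0\le a_i<2,\quad b_j,c_k\in\mathbb N=\{0,1,2,\dots\}.$$ (2) If $\mathfrak g$ is restricted with $p$-th power map $x\mapsto x^{[p]}$ on $\mathfrak g_0$, then its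 restricted enveloping algebra $\mathbf u(\mathfrak g)=U(\mathfrak g)/(x^p-x^{[p]}\mid x\in\mathfrak g_0)$ has a $\kappa$-basis consisting of the elements $$x_1^{a_1}\cdots x_{s_1}^{a_{s_1}}\,x_{s_1+1}^{b_1}\cdots x_s^{b_{s-s_1}}\,y_1^{c_1}\cdots y_{t_1}^{c_{t_1}},\qquad 0\le a_i<2,\quad 0\le b_j<2p,\quad 0\le c_k<p.$$ Here $\mathfrak g$ is called restricted if there is a map $\mathfrak g_0\to\mathfrak g_0$, $x\mapsto x^{[p]}$, such that $(cx)^{[p]}=c^px^{[p]}$ for $c\in\kappa$, $x\in\mathfrak g_0$; $[x^{[p]},y]=(\operatorname{ad}x)^p(y)$ for $x\in\mathfrak g_0$, $y\in\mathfrak g$; and $(x+y)^{[p]}=x^{[p]}+y^{[p]}+\sum_{i=1}^{p-1}s_i(x,y)$ for $x,y\in\mathfrak g_0$, where $i\,s_i(x,y)$ is the coefficient of $\lambda^{i-1}$ in $(\operatorname{ad}(\lambda x+y))^{p-1}(x)$. -/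

import Mathlib

universe u v

/-- A Lie superalgebra over a field `κ` (to be used in characteristic different from `2` and `3`)
with underlying vector space `g`: a `ℤ/2`-grading `g = g₀ ⊕ g₁` and an even bilinear bracket that
is super skew-symmetric and satisfies the super Jacobi identity. -/
structure LieSuperalgebra (κ : Type u) (g : Type v) [Field κ] [AddCommGroup g] [Module κ g] where
  /-- the homogeneous components; `grade 0` is the even part, `grade 1` the odd part -/
  grade : ZMod 2 → Submodule κ g
  isInternal : DirectSum.IsInternal grade
  /-- the superbracket -/
  bracket : g →ₗ[κ] g →ₗ[κ] g
  bracket_mem : ∀ (i j : ZMod 2) (a b : g), a ∈ grade i → b ∈ grade j →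
    bracket a b ∈ grade (i + j)
  skew : ∀ (i j : ZMod 2) (a b : g), a ∈ grade i → b ∈ grade j →
    bracket a b = -((-1 : κ) ^ (i.val * j.val) • bracket b a)
  jacobi : ∀ (i j : ZMod 2) (a b c : g), a ∈ grade i → b ∈ grade j →
    bracket a (bracket b c) =
      bracket (bracket a b) c + (-1 : κ) ^ (i.val * j.val) • bracket b (bracket a c)

namespace LieSuperalgebra

section

variable {κ : Type u} {g : Type v} [Field κ] [AddCommGroup g] [Module κ g]
variable (L : LieSuperalgebra κ g)

/-- The adjoint map `b ↦ [a, b]` on all of `g`. -/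
def ad (a : g) : Module.End κ g := L.bracket a

/-- `s_i(a, b)`: the element such that `i s_i(a, b)` is the coefficient of `λ ^ (i - 1)` in
`(ad (λ a + b)) ^ (p - 1) (a)`. The power is computed in polynomials in `λ` with coefficients in
`End g`. Only used for `1 ≤ i ≤ p - 1` in characteristic `p`, where `i` is invertible in `κ`. -/
noncomputable def jacobsonTerm (p i : ℕ) (a b : g) : g :=
  (i : κ)⁻¹ •
    (((Polynomial.X * Polynomial.C (L.ad a) + Polynomial.C (L.ad b)) ^ (p - 1)).coeff (i - 1)) a

/-- `pm` is a `p`-th power map `a ↦ a^[p]` on the even part, making `g` a restricted Lie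
superalgebra. -/
structure IsPMap (p : ℕ) (pm : L.grade 0 → L.grade 0) : Prop where
  smul : ∀ (c : κ) (a : L.grade 0), pm (c • a) = c ^ p • pm a
  ad_pow : ∀ (a : L.grade 0) (b : g), L.bracket (pm a : g) b = (L.ad (a : g) ^ p) b
  add : ∀ a b : L.grade 0, (pm (a + b) : g) =
    (pm a : g) + (pm b : g) + ∑ i ∈ Finset.Icc 1 (p - 1), L.jacobsonTerm p i (a : g) (b : g)

/-- The defining relations `a ⊗ b = [a, b] + (-1)^{|a||b|} b ⊗ a`, for homogeneous `a`, `b`, of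
the universal enveloping algebra. -/
inductive URel : TensorAlgebra κ g → TensorAlgebra κ g → Prop
  | mk (i j : ZMod 2) (a b : g) (ha : a ∈ L.grade i) (hb : b ∈ L.grade j) :
      URel (TensorAlgebra.ι κ a * TensorAlgebra.ι κ b)
        (TensorAlgebra.ι κ (L.bracket a b) +
          (-1 : κ) ^ (i.val * j.val) • (TensorAlgebra.ι κ b * TensorAlgebra.ι κ a))

/-- The universal enveloping algebra `U(g)`, as an associative algebra. -/
abbrev UEnv : Type (max u v) := RingQuot L.URel

/-- The canonical map `g → U(g)`. -/
noncomputable def ιU : g →ₗ[κ] L.UEnv :=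
  (RingQuot.mkAlgHom κ L.URel).toLinearMap ∘ₗ TensorAlgebra.ι κ

/-- The relations `a ^ p = a^[p]`, for even `a`, that cut the restricted enveloping algebra out of
`U(g)`. -/
inductive RRel (p : ℕ) (pm : L.grade 0 → L.grade 0) : L.UEnv → L.UEnv → Prop
  | mk (a : L.grade 0) : RRel p pm (L.ιU (a : g) ^ p) (L.ιU (pm a : g))

/-- The restricted enveloping algebra `u(g) = U(g) / (a ^ p - a^[p] | a ∈ g₀)`. -/
abbrev REnv (p : ℕ) (pm : L.grade 0 → L.grade 0) : Type (max u v) := RingQuot (L.RRel p pm)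

/-- The canonical map `g → u(g)`. -/
noncomputable def ιR (p : ℕ) (pm : L.grade 0 → L.grade 0) : g →ₗ[κ] L.REnv p pm :=
  (RingQuot.mkAlgHom κ (L.RRel p pm)).toLinearMap ∘ₗ L.ιU

end

end LieSuperalgebra

/-- The ordered monomial `x₁ ^ e₁ ⋯ x_n ^ e_n` in a monoid. -/
def orderedMonomial {A : Type*} [Monoid A] {n : ℕ} (x : Fin n → A) (e : Fin n → ℕ) : A :=
  (List.ofFn fun i => x i ^ e i).prod

/-! The heart of the matter is the Poincaré-Birkhoff-Witt theorem for a homogeneous basis: ordered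
monomials with odd exponents below 2 form a basis of U(g) (`exists_pbwBasis`), and those whose even
exponents are moreover below p form a basis of u(g) (`exists_restrictedPbwBasis`). The x_j, z_j and
y_k form such a basis of g. Order it so that each z_j comes right after x_j. As z_j = 2 x_j² in
U(g), x_j^a z_j^c is a nonzero multiple of x_j^(a+2c), and division by 2 with remainder matches the
PBW monomials with the required ones (`Letter.exists_basis`); c < p becomes b < 2p.

Independence in U(g) comes from the diamond lemma in the tensor algebra. Descents e_i e_j and
squares of odd letters are rewritten by the defining relations. Overlaps of three letters are
resolved by `commRel_syzygy`, which encodes the super Jacobi identity; the cube of an odd letter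
needs 3 to be invertible. The resulting normal form map kills the relations and fixes normal words.

For u(g), the elements ξ_a = a^p - a^[p] are central, and p-semilinear in a by Jacobson's formula
(`add_pow_char_eq`), so those of the even basis vectors generate the ideal. Replacing e^E by e^(E
mod p) ξ^(E div p) changes the PBW basis only in lower degree (`exists_pCentralBasis`). In the new
basis, multiplication by ξ_i raises the i-th exponent by p, so exactly the vectors with every even
exponent below p survive in the quotient. -/

/-! ### Normal forms and linear maps out of quotients -/

/-- The linear form of the diamond lemma. A reduction `R w f` rewrites the basis vector `b w` to a
combination `f` of smaller basis vectors. If any two reductions of `b w` agree modulo the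
reductions of smaller basis vectors, then there is a linear normal form map. -/
theorem exists_normalForm {X κ M : Type*} [Field κ] [AddCommGroup M] [Module κ M]
    (b : Module.Basis X κ M) (lt : X → X → Prop) (wf : WellFounded lt) (R : X → M → Prop)
    (hlow : ∀ w f, R w f → f ∈ Submodule.span κ {m | ∃ v, lt v w ∧ m = b v})
    (hconf : ∀ w f f', R w f → R w f' →
      f - f' ∈ Submodule.span κ {m | ∃ v h, lt v w ∧ R v h ∧ m = b v - h}) :
    ∃ σ : M →ₗ[κ] M, (∀ w f, R w f → σ (b w) = σ f) ∧
      (∀ w, (∀ f, ¬ R w f) → σ (b w) = b w) := by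
  classical
  -- One reduction of each reducible vector is chosen and normalised recursively. The value 0 for
  -- terms not below `w` is a default that `hlow` rules out.
  let S : X → M := wf.fix fun w S =>
    if h : ∃ f, R w f then
      (b.repr h.choose).sum fun v c => if hv : lt v w then c • S v hv else 0
    else b w
  have hS : ∀ w, S w = if h : ∃ f, R w f then
      (b.repr h.choose).sum fun v c => if lt v w then c • S v else 0
      else b w := by
    intro w
    simp only [S]
    rw [wf.fix_eq]
    simp only [dite_eq_ite]
  let σ : M →ₗ[κ] M := b.constr κ S
  have hσ : ∀ w, σ (b w) = S w := fun w => b.constr_basis κ S w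
  have hsub : ∀ w f, f ∈ Submodule.span κ {m | ∃ v, lt v w ∧ m = b v} →
      ((b.repr f).sum fun v c => if lt v w then c • S v else 0) = σ f := by
    intro w f hf
    have hsupp : ∀ v, b.repr f v ≠ 0 → lt v w := by
      induction hf using Submodule.span_induction with
      | mem m hm =>
        obtain ⟨u, hu, rfl⟩ := hm
        intro v hv
        by_cases huv : u = v
        · exact huv ▸ hu
        · simp [huv] at hv
      | zero => simp
      | add x y _ _ hx hy =>
        intro v hv
        by_cases h1 : b.repr x v = 0
        · refine hy v fun h2 => hv ?_
          simp [h1, h2]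
        · exact hx v h1
      | smul a x _ hx =>
        intro v hv
        refine hx v fun h2 => hv ?_
        simp [h2]
    rw [Module.Basis.constr_apply]
    refine Finsupp.sum_congr fun v hv => ?_
    rw [if_pos (hsupp v (Finsupp.mem_support_iff.1 hv))]
  have key : ∀ w f, R w f → σ (b w) = σ f := by
    intro w
    induction w using wf.induction with
    | _ w ih =>
      intro f hf
      have hex : ∃ f, R w f := ⟨f, hf⟩
      rw [hσ, hS, dif_pos hex, hsub w _ (hlow w _ hex.choose_spec), ← sub_eq_zero, ← map_sub]
      -- By induction `σ` kills the relations below `w`, so by confluence the chosen reduction and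
      -- the given one have the same image.
      have hle : Submodule.span κ {m | ∃ v h, lt v w ∧ R v h ∧ m = b v - h} ≤
          LinearMap.ker σ := by
        rw [Submodule.span_le]
        rintro _ ⟨v, h, hv, hR, rfl⟩
        simp [ih v hv h hR]
      exact hle (hconf w _ _ hex.choose_spec hf)
  refine ⟨σ, key, fun w hw => ?_⟩
  rw [hσ, hS, dif_neg]
  rintro ⟨f, hf⟩
  exact hw f hf

/-- A linear map that does not see the relations, in any context, descends to the quotient. -/
theorem RingQuot.exists_linearMap {κ A M : Type*} [Field κ] [Ring A] [Algebra κ A]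
    [AddCommGroup M] [Module κ M] (r : A → A → Prop) (π : A →ₗ[κ] M)
    (h : ∀ x y, r x y → ∀ a c, π (a * x * c) = π (a * y * c)) :
    ∃ φ : RingQuot r →ₗ[κ] M, ∀ a, φ (RingQuot.mkAlgHom κ r a) = π a := by
  -- The largest two-sided ideal inside `ker π`, taken as a left ideal: related elements act equally
  -- on `A ⧸ J`, so the action factors through `RingQuot r`, and the class of 1 recovers `π`.
  let J : Submodule A A :=
    { carrier := {u | ∀ a c, π (a * u * c) = 0}
      add_mem' := fun {u v} hu hv a c => by simp [mul_add, add_mul, hu a c, hv a c]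
      zero_mem' := fun a c => by simp
      smul_mem' := fun d u hu a c => by simpa [mul_assoc] using hu (a * d) c }
  let ρ : A →ₐ[κ] Module.End κ (A ⧸ J) := Algebra.lsmul κ κ (A ⧸ J)
  have hρ : ∀ a q, ρ a (Submodule.Quotient.mk q) = Submodule.Quotient.mk (a * q) :=
    fun a q => rfl
  have hrel : ∀ ⦃x y⦄, r x y → ρ x = ρ y := by
    intro x y hxy
    refine LinearMap.ext fun q => ?_
    obtain ⟨q, rfl⟩ := Submodule.Quotient.mk_surjective J q
    rw [hρ, hρ, Submodule.Quotient.eq]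
    intro a c
    have := h x y hxy a (q * c)
    simp only [mul_sub, sub_mul, map_sub, sub_eq_zero]
    simpa [mul_assoc] using this
  let ρ' : RingQuot r →ₐ[κ] Module.End κ (A ⧸ J) := RingQuot.liftAlgHom κ ⟨ρ, hrel⟩
  have hker : J.restrictScalars κ ≤ LinearMap.ker π := by
    intro u hu
    simpa using hu 1 1
  let π' : (A ⧸ J) →ₗ[κ] M := (J.restrictScalars κ).liftQ π hker ∘ₗ
    (Submodule.Quotient.restrictScalarsEquiv κ J).symm.toLinearMap
  have hπ' : ∀ a, π' (Submodule.Quotient.mk a) = π a := fun a => rfl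
  refine ⟨π' ∘ₗ LinearMap.applyₗ (Submodule.Quotient.mk 1) ∘ₗ ρ'.toLinearMap, fun a => ?_⟩
  have : ρ' (RingQuot.mkAlgHom κ r a) = ρ a := RingQuot.liftAlgHom_mkAlgHom_apply _ _ _ _
  change π' (ρ' (RingQuot.mkAlgHom κ r a) (Submodule.Quotient.mk 1)) = π a
  rw [this, hρ, hπ', mul_one]

/-! ### The order on words -/

theorem List.Lex.append_of_length_eq {α : Type*} {r : α → α → Prop} {s t : List α}
    (hl : s.length = t.length) (h : List.Lex r s t) (u : List α) :
    List.Lex r (s ++ u) (t ++ u) := by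
  induction h with
  | nil => simp at hl
  | cons _ ih => exact List.Lex.cons (ih (by simpa using hl))
  | rel h => exact List.Lex.rel h

/-- This compatibility with concatenation lets a rewriting inside a word lower the whole word. -/
theorem List.Shortlex.append_append {α : Type*} {r : α → α → Prop} {s t : List α}
    (h : List.Shortlex r s t) (u v : List α) :
    List.Shortlex r (u ++ s ++ v) (u ++ t ++ v) := by
  rw [List.append_assoc, List.append_assoc]
  refine List.Shortlex.append_left ?_ u
  rcases List.shortlex_def.1 h with h | ⟨h, h'⟩
  · exact List.Shortlex.of_length_lt (by simpa using h)
  · exact List.Shortlex.of_lex (by simpa using h) (List.Lex.append_of_length_eq h h' v)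

/-! ### Relations and reductions in the tensor algebra -/

namespace LieSuperalgebra

variable {κ : Type*} {g : Type*} [Field κ] [AddCommGroup g] [Module κ g]

variable (κ) in
/-- The sign `(-1) ^ (αβ)` of the interchange of elements of parities `α` and `β`. -/
def koszulSign (α β : ZMod 2) : κ := (-1) ^ (α.val * β.val)

theorem koszulSign_comm (α β : ZMod 2) : koszulSign κ α β = koszulSign κ β α := by
  rw [koszulSign, koszulSign, mul_comm]

theorem koszulSign_one_one : koszulSign κ 1 1 = -1 := by
  simp [koszulSign, ZMod.val_one]

theorem koszulSign_zero_left (β : ZMod 2) : koszulSign κ 0 β = 1 := by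
  simp [koszulSign]

theorem koszulSign_zero_right (β : ZMod 2) : koszulSign κ β 0 = 1 := by
  simp [koszulSign]

theorem parity_cases (α : ZMod 2) : α = 0 ∨ α = 1 := by
  revert α; decide

theorem koszulSign_mul_self (α β : ZMod 2) : koszulSign κ α β * koszulSign κ α β = 1 := by
  rcases parity_cases α with rfl | rfl <;> rcases parity_cases β with rfl | rfl <;>
    simp [koszulSign_one_one, koszulSign_zero_left, koszulSign_zero_right]

variable (L : LieSuperalgebra κ g)

/-- The defining relation of the enveloping algebra, as an element of the tensor algebra. -/
noncomputable def commRel (α β : ZMod 2) (a b : g) : TensorAlgebra κ g :=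
  TensorAlgebra.ι κ a * TensorAlgebra.ι κ b -
    koszulSign κ α β • (TensorAlgebra.ι κ b * TensorAlgebra.ι κ a) -
    TensorAlgebra.ι κ (L.bracket a b)

theorem bracket_skew {α β : ZMod 2} {a b : g} (ha : a ∈ L.grade α) (hb : b ∈ L.grade β) :
    L.bracket a b = -(koszulSign κ α β • L.bracket b a) :=
  L.skew α β a b ha hb

theorem commRel_skew {α β : ZMod 2} {a b : g} (ha : a ∈ L.grade α) (hb : b ∈ L.grade β) :
    L.commRel α β a b = -(koszulSign κ α β • L.commRel β α b a) := by
  simp only [commRel, L.bracket_skew ha hb, koszulSign_comm β α, map_neg, map_smul, smul_sub,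
    smul_smul, koszulSign_mul_self]
  module

/-- The relation among relations that resolves the overlaps of three letters. -/
theorem commRel_syzygy {α β γ : ZMod 2} {a b c : g} (ha : a ∈ L.grade α) (hb : b ∈ L.grade β) :
    L.commRel α β a b * TensorAlgebra.ι κ c - TensorAlgebra.ι κ a * L.commRel β γ b c +
      koszulSign κ α β • (TensorAlgebra.ι κ b * L.commRel α γ a c) +
      (koszulSign κ α β * koszulSign κ α γ) • (L.commRel β γ b c * TensorAlgebra.ι κ a) -
      koszulSign κ β γ • (L.commRel α γ a c * TensorAlgebra.ι κ b) -
      (koszulSign κ β γ * koszulSign κ α γ) • (TensorAlgebra.ι κ c * L.commRel α β a b) =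
    -L.commRel (α + β) γ (L.bracket a b) c + L.commRel α (β + γ) a (L.bracket b c) -
      koszulSign κ α β • L.commRel β (α + γ) b (L.bracket a c) := by
  -- The cubic terms cancel on the left, the quadratic terms agree on both sides, and the linear
  -- terms on the right vanish by the Jacobi identity.
  have hj := L.jacobi α β a b c ha hb
  change _ = _ + koszulSign κ α β • _ at hj
  have h2 : (1 : ZMod 2) + 1 = 0 := rfl
  simp only [commRel, hj, map_add, map_smul]
  rcases parity_cases α with rfl | rfl <;> rcases parity_cases β with rfl | rfl <;>
    rcases parity_cases γ with rfl | rfl <;>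
    simp only [koszulSign_one_one, koszulSign_zero_left, koszulSign_zero_right, add_zero, zero_add,
      h2, mul_sub, sub_mul, mul_assoc, one_smul, neg_smul, mul_neg, neg_mul, mul_one,
      neg_neg] <;> abel

variable {n : ℕ} (e : Module.Basis (Fin n) κ g) (par : Fin n → ZMod 2)

/-- The product in the tensor algebra of the basis elements of a word. -/
noncomputable def word (w : List (Fin n)) : TensorAlgebra κ g :=
  (w.map fun i => TensorAlgebra.ι κ (e i)).prod

theorem word_append (v w : List (Fin n)) : word e (v ++ w) = word e v * word e w := by
  simp [word]

theorem word_cons (i : Fin n) (w : List (Fin n)) :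
    word e (i :: w) = TensorAlgebra.ι κ (e i) * word e w := by
  simp [word]

theorem word_nil : word e [] = 1 := rfl

theorem exists_wordBasis : ∃ b : Module.Basis (List (Fin n)) κ (TensorAlgebra κ g),
    ∀ w, b w = word e w := by
  refine ⟨(e.tensorAlgebra).reindex FreeMonoid.toList, fun w => ?_⟩
  rw [Module.Basis.reindex_apply]
  change (TensorAlgebra.equivFreeAlgebra e).symm (FreeAlgebra.basisFreeMonoid κ (Fin n)
    (FreeMonoid.ofList w)) = _
  have h : FreeAlgebra.basisFreeMonoid κ (Fin n) (FreeMonoid.ofList w) =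
      (w.map (FreeAlgebra.ι κ)).prod := by
    rw [FreeAlgebra.basisFreeMonoid, Module.Basis.map_apply, LinearEquiv.symm_apply_eq]
    have hw : FreeAlgebra.equivMonoidAlgebraFreeMonoid (R := κ) (w.map (FreeAlgebra.ι κ)).prod =
        MonoidAlgebra.of κ (FreeMonoid (Fin n)) (FreeMonoid.ofList w) := by
      induction w with
      | nil => simp [MonoidAlgebra.one_def]
      | cons i w ih =>
        rw [List.map_cons, List.prod_cons, map_mul, ih, FreeMonoid.ofList_cons, map_mul]
        congr 1
        exact FreeAlgebra.lift_ι_apply _ _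
    simpa using congrArg MonoidAlgebra.coeff hw.symm
  rw [h, map_list_prod, List.map_map, word]
  congr 2
  funext i
  simp

theorem mem_of_basis_mem {N : Submodule κ (TensorAlgebra κ g)} {A B : TensorAlgebra κ g}
    (h : ∀ k, A * TensorAlgebra.ι κ (e k) * B ∈ N) (u : g) :
    A * TensorAlgebra.ι κ u * B ∈ N := by
  induction e.mem_span u using Submodule.span_induction with
  | mem x hx => obtain ⟨k, rfl⟩ := hx; exact h k
  | zero => simp
  | add x y _ _ hx hy => simpa [mul_add, add_mul] using N.add_mem hx hy
  | smul c x _ hx => simpa using N.smul_mem c hx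

/-- The part of `a` along basis vectors of the other parity lies in both homogeneous components,
hence is zero. -/
theorem mem_span_of_mem_grade (he : ∀ i, e i ∈ L.grade (par i)) {α : ZMod 2} {a : g}
    (ha : a ∈ L.grade α) : a ∈ Submodule.span κ {b | ∃ i, par i = α ∧ b = e i} := by
  classical
  have hmem : ∀ (β : ZMod 2) (s : Finset (Fin n)), (∀ i ∈ s, par i = β) →
      ∑ i ∈ s, e.repr a i • e i ∈ L.grade β := fun β s hs =>
    Submodule.sum_mem _ fun i hi => Submodule.smul_mem _ _ (hs i hi ▸ he i)
  have hsum := e.sum_repr a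
  rw [← Finset.sum_filter_add_sum_filter_not Finset.univ (fun i => par i = α)] at hsum
  have h1 := hmem α (Finset.univ.filter fun i => par i = α) (by simp)
  have h2 := hmem (α + 1) (Finset.univ.filter fun i => ¬ par i = α) (by
    intro i hi
    simp only [Finset.mem_filter, Finset.mem_univ, true_and] at hi
    exact (by decide : ∀ β γ : ZMod 2, ¬ β = γ → β = γ + 1) _ _ hi)
  have hdisj : Disjoint (L.grade α) (L.grade (α + 1)) :=
    L.isInternal.submodule_iSupIndep.pairwiseDisjoint
      ((by decide : ∀ β : ZMod 2, β ≠ β + 1) α)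
  have h3 : ∑ i ∈ Finset.univ.filter (fun i => ¬ par i = α), e.repr a i • e i = 0 := by
    refine (Submodule.disjoint_def.1 hdisj) _ ?_ h2
    rw [← hsum] at ha
    exact (Submodule.add_mem_iff_right _ h1).1 ha
  rw [h3, add_zero] at hsum
  rw [← hsum]
  refine Submodule.sum_mem _ fun i hi => Submodule.smul_mem _ _ (Submodule.subset_span ⟨i, ?_, rfl⟩)
  simpa using hi

variable {L e par}

/-- By bilinearity, relations between basis vectors control those between all homogeneous elements.
-/
theorem mem_of_basis_rel_mem (he : ∀ i, e i ∈ L.grade (par i))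
    {N : Submodule κ (TensorAlgebra κ g)}
    (h : ∀ i j, L.commRel (par i) (par j) (e i) (e j) ∈ N) {α β : ZMod 2} {a b : g}
    (ha : a ∈ L.grade α) (hb : b ∈ L.grade β) : L.commRel α β a b ∈ N := by
  have key : ∀ i, L.commRel (par i) β (e i) b ∈ N := by
    intro i
    have hb' := L.mem_span_of_mem_grade e par he hb
    clear hb
    induction hb' using Submodule.span_induction with
    | mem x hx => obtain ⟨k, rfl, rfl⟩ := hx; exact h i k
    | zero => simp [commRel]
    | add x y _ _ hx hy =>
      have : L.commRel (par i) β (e i) (x + y) =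
          L.commRel (par i) β (e i) x + L.commRel (par i) β (e i) y := by
        simp only [commRel, map_add, mul_add, add_mul]; module
      rw [this]; exact N.add_mem hx hy
    | smul c x _ hx =>
      have : L.commRel (par i) β (e i) (c • x) = c • L.commRel (par i) β (e i) x := by
        simp only [commRel, map_smul, mul_smul_comm, smul_mul_assoc]; module
      rw [this]; exact N.smul_mem c hx
  have ha' := L.mem_span_of_mem_grade e par he ha
  clear ha
  induction ha' using Submodule.span_induction with
  | mem x hx => obtain ⟨k, rfl, rfl⟩ := hx; exact key k
  | zero => simp [commRel]
  | add x y _ _ hx hy =>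
    have : L.commRel α β (x + y) b = L.commRel α β x b + L.commRel α β y b := by
      simp only [commRel, map_add, mul_add, add_mul, LinearMap.add_apply]; module
    rw [this]; exact N.add_mem hx hy
  | smul c x _ hx =>
    have : L.commRel α β (c • x) b = c • L.commRel α β x b := by
      simp only [commRel, map_smul, mul_smul_comm, smul_mul_assoc, LinearMap.smul_apply]; module
    rw [this]; exact N.smul_mem c hx

variable (L e par)

variable (κ) in
/-- The letters `i`, `j` form a reducible pair, whose relation has leading coefficient `c⁻¹`. -/
def Reducible (c : κ) (i j : Fin n) : Prop :=
  (j < i ∧ c = 1) ∨ (j = i ∧ par i = 1 ∧ c = 2⁻¹)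

/-- The relation between two basis elements. -/
noncomputable abbrev letterRel (i j : Fin n) : TensorAlgebra κ g :=
  L.commRel (par i) (par j) (e i) (e j)

/-- The reductions of words that bring two neighbouring letters into order. -/
def Reduction (w : List (Fin n)) (f : TensorAlgebra κ g) : Prop :=
  ∃ A B i j c, w = A ++ i :: j :: B ∧ Reducible κ par c i j ∧
    f = word e w - c • (word e A * letterRel L e par i j * word e B)

/-- The span of the reductions of words below `w`. -/
noncomputable def lowerRel (w : List (Fin n)) : Submodule κ (TensorAlgebra κ g) :=
  Submodule.span κ {m | ∃ v h, List.Shortlex (· < ·) v w ∧ Reduction L e par v h ∧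
    m = word e v - h}

variable {L e par}

theorem Reducible.ne_zero (h2 : (2 : κ) ≠ 0) {c : κ} {i j : Fin n} (h : Reducible κ par c i j) :
    c ≠ 0 := by
  rcases h with ⟨-, rfl⟩ | ⟨-, -, rfl⟩
  · exact one_ne_zero
  · exact inv_ne_zero h2

theorem Reducible.mem_lowerRel (h2 : (2 : κ) ≠ 0) {c : κ} {i j : Fin n}
    (h : Reducible κ par c i j) {A B w : List (Fin n)}
    (hw : List.Shortlex (· < ·) (A ++ i :: j :: B) w) :
    word e A * letterRel L e par i j * word e B ∈ lowerRel L e par w := by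
  rw [← Submodule.smul_mem_iff _ (h.ne_zero h2)]
  refine Submodule.subset_span ⟨_, _, hw, ⟨A, B, i, j, c, rfl, h, rfl⟩, ?_⟩
  abel

/-- Skew-symmetry turns an ascending pair into a reducible one, hence the bounds on both words. An
even letter has zero relation with itself, because 2 is invertible. -/
theorem letterRel_mem_lowerRel (h2 : (2 : κ) ≠ 0) (he : ∀ i, e i ∈ L.grade (par i))
    {i j : Fin n} {A B w : List (Fin n)}
    (hw : List.Shortlex (· < ·) (A ++ i :: j :: B) w)
    (hw' : List.Shortlex (· < ·) (A ++ j :: i :: B) w) :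
    word e A * letterRel L e par i j * word e B ∈ lowerRel L e par w := by
  have hskew : letterRel L e par i j = -(koszulSign κ (par i) (par j) • letterRel L e par j i) :=
    L.commRel_skew (he i) (he j)
  rcases lt_trichotomy i j with h | rfl | h
  · rw [hskew, mul_neg, neg_mul, mul_smul_comm, smul_mul_assoc]
    exact Submodule.neg_mem _ (Submodule.smul_mem _ _
      (Reducible.mem_lowerRel h2 (c := 1) (Or.inl ⟨h, rfl⟩) hw'))
  · rcases parity_cases (par i) with h0 | h1
    · rw [h0, koszulSign_zero_left, one_smul, eq_neg_iff_add_eq_zero, ← two_smul κ,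
        smul_eq_zero_iff_right h2] at hskew
      rw [hskew]
      simp
    · exact Reducible.mem_lowerRel h2 (Or.inr ⟨rfl, h1, rfl⟩) hw
  · exact Reducible.mem_lowerRel h2 (c := 1) (Or.inl ⟨h, rfl⟩) hw

/-- Length alone puts the words involved below `w`, whatever their letters. This disposes of the
relations with a bracket as argument in `commRel_syzygy`. -/
theorem commRel_mem_lowerRel (h2 : (2 : κ) ≠ 0) (he : ∀ i, e i ∈ L.grade (par i))
    {A B w : List (Fin n)} (hw : A.length + B.length + 2 < w.length) {α β : ZMod 2} {a b : g}
    (ha : a ∈ L.grade α) (hb : b ∈ L.grade β) :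
    word e A * L.commRel α β a b * word e B ∈ lowerRel L e par w := by
  let F : TensorAlgebra κ g →ₗ[κ] TensorAlgebra κ g :=
    LinearMap.mulRight κ (word e B) ∘ₗ LinearMap.mulLeft κ (word e A)
  refine mem_of_basis_rel_mem (N := (lowerRel L e par w).comap F) he (fun i j => ?_) ha hb
  refine letterRel_mem_lowerRel h2 he ?_ ?_ <;> apply List.Shortlex.of_length_lt <;>
    simp <;> omega

end LieSuperalgebra

/-! ### Confluence -/

namespace LieSuperalgebra

variable {κ : Type*} {g : Type*} [Field κ] [AddCommGroup g] [Module κ g]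
variable {L : LieSuperalgebra κ g} {n : ℕ} {e : Module.Basis (Fin n) κ g} {par : Fin n → ZMod 2}

/-- The span of the words below `w`. -/
noncomputable def lowerWord (e : Module.Basis (Fin n) κ g) (w : List (Fin n)) :
    Submodule κ (TensorAlgebra κ g) :=
  Submodule.span κ {m | ∃ v, List.Shortlex (· < ·) v w ∧ m = word e v}

theorem word_mem_lowerWord {v w : List (Fin n)} (h : List.Shortlex (· < ·) v w) :
    word e v ∈ lowerWord e w :=
  Submodule.subset_span ⟨v, h, rfl⟩

/-- Scaling by `c` makes the relation monic: an odd letter gives twice its square, whence the factor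
1/2, and a descent already has leading coefficient 1. -/
theorem Reducible.exists_eq (h2 : (2 : κ) ≠ 0) {c : κ} {i j : Fin n}
    (h : Reducible κ par c i j) :
    ∃ φ ∈ lowerWord e [i, j], c • letterRel L e par i j = word e [i, j] - φ := by
  have hι : ∀ u : g, TensorAlgebra.ι κ u ∈ lowerWord e [i, j] := by
    intro u
    have := mem_of_basis_mem e (N := lowerWord e [i, j]) (A := 1) (B := 1) (fun k => by
      simpa [word] using word_mem_lowerWord (e := e) (v := [k]) (w := [i, j])
        (List.Shortlex.of_length_lt (by simp))) u
    simpa using this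
  rcases h with ⟨hij, rfl⟩ | ⟨rfl, hp, rfl⟩
  · refine ⟨koszulSign κ (par i) (par j) • word e [j, i] +
      TensorAlgebra.ι κ (L.bracket (e i) (e j)), ?_, ?_⟩
    · exact Submodule.add_mem _ (Submodule.smul_mem _ _ (word_mem_lowerWord
        (List.Shortlex.of_lex rfl (List.Lex.rel hij)))) (hι _)
    · simp only [letterRel, commRel, word_cons, word_nil, mul_one]
      module
  · refine ⟨(2 : κ)⁻¹ • TensorAlgebra.ι κ (L.bracket (e j) (e j)),
      Submodule.smul_mem _ _ (hι _), ?_⟩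
    simp only [letterRel, commRel, word_cons, word_nil, mul_one, hp, koszulSign_one_one]
    match_scalars <;> field_simp
    norm_num

theorem lowerWord_mul_mul {u : List (Fin n)} {φ : TensorAlgebra κ g}
    {N : Submodule κ (TensorAlgebra κ g)} {X Y : TensorAlgebra κ g}
    (hφ : φ ∈ lowerWord e u) (h : ∀ v, List.Shortlex (· < ·) v u → X * word e v * Y ∈ N) :
    X * φ * Y ∈ N := by
  induction hφ using Submodule.span_induction with
  | mem x hx => obtain ⟨k, hk, rfl⟩ := hx; exact h k hk
  | zero => simp
  | add x y _ _ hx hy => simpa [mul_add, add_mul] using N.add_mem hx hy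
  | smul c x _ hx => simpa using N.smul_mem c hx

theorem Reduction.mem_lowerWord (h2 : (2 : κ) ≠ 0) {w : List (Fin n)} {f : TensorAlgebra κ g}
    (h : Reduction L e par w f) : f ∈ lowerWord e w := by
  obtain ⟨A, B, i, j, c, rfl, hr, rfl⟩ := h
  obtain ⟨φ, hφ, hc⟩ := hr.exists_eq (L := L) (e := e) h2
  have : word e (A ++ i :: j :: B) -
      c • (word e A * letterRel L e par i j * word e B) = word e A * φ * word e B := by
    rw [← smul_mul_assoc, ← mul_smul_comm, hc]
    simp only [word_append, word_cons, word_nil]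
    noncomm_ring
  rw [this]
  refine lowerWord_mul_mul hφ fun v hv => ?_
  rw [← word_append, ← word_append]
  exact word_mem_lowerWord (by simpa using hv.append_append A B)

/-- Two reductions at disjoint places are confluent. -/
theorem disjoint_confluent (h2 : (2 : κ) ≠ 0) {A M B : List (Fin n)} {i j k l : Fin n} {c d : κ}
    (hc : Reducible κ par c i j) (hd : Reducible κ par d k l) :
    c • (word e A * letterRel L e par i j * word e (M ++ k :: l :: B)) -
      d • (word e (A ++ i :: j :: M) * letterRel L e par k l * word e B) ∈
    lowerRel L e par (A ++ i :: j :: (M ++ k :: l :: B)) := by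
  obtain ⟨φ, hφ, hcφ⟩ := hc.exists_eq (L := L) (e := e) h2
  obtain ⟨ψ, hψ, hdψ⟩ := hd.exists_eq (L := L) (e := e) h2
  -- Writing r and r' for the scaled relations, ij = r + φ and kl = r' + ψ, so r M kl - ij M r' = r
  -- M ψ - φ M r'; both terms are relations in lower words.
  have key : c • (word e A * letterRel L e par i j * word e (M ++ k :: l :: B)) -
      d • (word e (A ++ i :: j :: M) * letterRel L e par k l * word e B) =
      c • ((word e A * letterRel L e par i j * word e M) * ψ * word e B) -
      d • (word e A * φ * (word e M * letterRel L e par k l * word e B)) := by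
    have e1 : ∀ X Y, c • (X * letterRel L e par i j * Y) = X * (word e [i, j] - φ) * Y := by
      intro X Y; rw [← hcφ]; simp
    have e2 : ∀ X Y, d • (X * letterRel L e par k l * Y) = X * (word e [k, l] - ψ) * Y := by
      intro X Y; rw [← hdψ]; simp
    have e3 : c • ((word e A * letterRel L e par i j * word e M) * ψ * word e B) =
        word e A * (word e [i, j] - φ) * (word e M * ψ * word e B) := by
      rw [← e1]; simp only [mul_assoc]
    have e4 : d • (word e A * φ * (word e M * letterRel L e par k l * word e B)) =
        word e A * φ * word e M * (word e [k, l] - ψ) * word e B := by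
      rw [← e2]; simp only [mul_assoc]
    rw [e1, e2, e3, e4]
    simp only [word_append, word_cons, word_nil]
    noncomm_ring
  rw [key]
  refine Submodule.sub_mem _ (Submodule.smul_mem _ _ ?_) (Submodule.smul_mem _ _ ?_)
  · refine lowerWord_mul_mul hψ fun v hv => ?_
    have : word e A * letterRel L e par i j * word e M * word e v * word e B =
        word e A * letterRel L e par i j * word e (M ++ v ++ B) := by
      simp only [word_append, mul_assoc]
    rw [this]
    refine hc.mem_lowerRel h2 ?_
    simpa using hv.append_append (A ++ i :: j :: M) B
  · refine lowerWord_mul_mul hφ fun v hv => ?_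
    have : word e A * word e v * (word e M * letterRel L e par k l * word e B) =
        word e (A ++ v ++ M) * letterRel L e par k l * word e B := by
      simp only [word_append, mul_assoc]
    rw [this]
    refine hd.mem_lowerRel h2 ?_
    simpa using hv.append_append A (M ++ k :: l :: B)

/-- Two overlapping reductions are confluent. -/
theorem overlap_confluent (h2 : (2 : κ) ≠ 0) (h3 : (3 : κ) ≠ 0)
    (he : ∀ i, e i ∈ L.grade (par i)) {A B : List (Fin n)} {i j k : Fin n} {c d : κ}
    (hc : Reducible κ par c i j) (hd : Reducible κ par d j k) :
    c • (word e A * letterRel L e par i j * word e (k :: B)) -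
      d • (word e (A ++ [i]) * letterRel L e par j k * word e B) ∈
    lowerRel L e par (A ++ i :: j :: k :: B) := by
  let F : TensorAlgebra κ g →ₗ[κ] TensorAlgebra κ g :=
    LinearMap.mulRight κ (word e B) ∘ₗ LinearMap.mulLeft κ (word e A)
  let N := (lowerRel L e par (A ++ i :: j :: k :: B)).comap F
  have hN : ∀ t, t ∈ N ↔ word e A * t * word e B ∈ lowerRel L e par (A ++ i :: j :: k :: B) :=
    fun t => Iff.rfl
  let a := TensorAlgebra.ι κ (e i)
  let b := TensorAlgebra.ι κ (e j)
  let z := TensorAlgebra.ι κ (e k)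
  have hshort : ∀ {α β : ZMod 2} {u v : g}, u ∈ L.grade α → v ∈ L.grade β →
      L.commRel α β u v ∈ N := fun hu hv =>
    commRel_mem_lowerRel h2 he (by simp; omega) hu hv
  have hleft : ∀ {l x y : Fin n}, List.Lex (· < ·) [l, x, y] [i, j, k] →
      List.Lex (· < ·) [l, y, x] [i, j, k] →
      TensorAlgebra.ι κ (e l) * letterRel L e par x y ∈ N := by
    intro l x y h h'
    have : word e A * (TensorAlgebra.ι κ (e l) * letterRel L e par x y) * word e B =
        word e (A ++ [l]) * letterRel L e par x y * word e B := by
      simp only [word_append, word_cons, word_nil, mul_one, mul_assoc]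
    rw [hN, this]
    refine letterRel_mem_lowerRel h2 he ?_ ?_
    · simpa using (List.Shortlex.of_lex (by rfl) h).append_append A B
    · simpa using (List.Shortlex.of_lex (by rfl) h').append_append A B
  have hright : ∀ {l x y : Fin n}, List.Lex (· < ·) [x, y, l] [i, j, k] →
      List.Lex (· < ·) [y, x, l] [i, j, k] →
      letterRel L e par x y * TensorAlgebra.ι κ (e l) ∈ N := by
    intro l x y h h'
    have : word e A * (letterRel L e par x y * TensorAlgebra.ι κ (e l)) * word e B =
        word e A * letterRel L e par x y * word e (l :: B) := by
      simp only [word_cons, mul_assoc]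
    rw [hN, this]
    refine letterRel_mem_lowerRel h2 he ?_ ?_
    · simpa using (List.Shortlex.of_lex (by rfl) h).append_append A B
    · simpa using (List.Shortlex.of_lex (by rfl) h').append_append A B
  have hsyz := L.commRel_syzygy (γ := par k) (c := e k) (he i) (he j)
  have hmem := N.sub_mem (N.add_mem (N.neg_mem
    (hshort (L.bracket_mem _ _ _ _ (he i) (he j)) (he k)))
    (hshort (he i) (L.bracket_mem _ _ _ _ (he j) (he k))))
    (N.smul_mem (koszulSign κ (par i) (par j))
      (hshort (he j) (L.bracket_mem _ _ _ _ (he i) (he k))))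
  rw [← hsyz] at hmem
  have hgoal : c • (word e A * letterRel L e par i j * word e (k :: B)) -
      d • (word e (A ++ [i]) * letterRel L e par j k * word e B) =
      F (c • (letterRel L e par i j * z) - d • (a * letterRel L e par j k)) := by
    simp only [F, map_sub, map_smul, LinearMap.comp_apply, LinearMap.mulLeft_apply,
      LinearMap.mulRight_apply, word_append, word_cons, word_nil, mul_one, mul_assoc, a, z]
  rw [hgoal]
  change c • (letterRel L e par i j * z) - d • (a * letterRel L e par j k) ∈ N
  rcases hc with ⟨hij, rfl⟩ | ⟨rfl, hp, rfl⟩ <;> rcases hd with ⟨hjk, rfl⟩ | ⟨rfl, hp', rfl⟩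
  -- Strict descent: the other four terms of the syzygy involve only permutations of the three
  -- letters below `[i, j, k]`.
  · have m1 : b * letterRel L e par i k ∈ N := hleft (.rel hij) (.rel hij)
    have m2 : letterRel L e par j k * a ∈ N := hright (.rel hij) (.rel (hjk.trans hij))
    have m3 : letterRel L e par i k * b ∈ N := hright (.cons (.rel hjk)) (.rel (hjk.trans hij))
    have m4 : z * letterRel L e par i j ∈ N := hleft (.rel (hjk.trans hij)) (.rel (hjk.trans hij))
    have := N.add_mem (N.add_mem (N.sub_mem (N.sub_mem hmem
      (N.smul_mem (koszulSign κ (par i) (par j)) m1))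
      (N.smul_mem (koszulSign κ (par i) (par j) * koszulSign κ (par i) (par k)) m2))
      (N.smul_mem (koszulSign κ (par j) (par k)) m3))
      (N.smul_mem (koszulSign κ (par j) (par k) * koszulSign κ (par i) (par k)) m4)
    convert this using 1
    simp only [letterRel, a, b, z]
    module
  -- With the last two letters equal and odd, terms of the syzygy coincide in pairs; half of it
  -- contains the desired difference.
  · have m1 : z * letterRel L e par i k ∈ N := hleft (.rel hij) (.rel hij)
    have m2 : letterRel L e par k k * a ∈ N := hright (.rel hij) (.rel hij)
    have := N.sub_mem (N.sub_mem (N.smul_mem (2 : κ)⁻¹ hmem)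
      (N.smul_mem (koszulSign κ (par i) (par k)) m1)) (N.smul_mem (2 : κ)⁻¹ m2)
    convert this using 1
    simp only [letterRel, a, z, hp', koszulSign_one_one, koszulSign_mul_self]
    match_scalars <;> field_simp <;> ring
  · have m1 : letterRel L e par j k * a ∈ N := hright (.cons (.rel hjk)) (.rel hjk)
    have m2 : z * letterRel L e par j j ∈ N := hleft (.rel hjk) (.rel hjk)
    have := N.add_mem (N.add_mem (N.smul_mem (2 : κ)⁻¹ hmem)
      (N.smul_mem (koszulSign κ (par j) (par k)) m1)) (N.smul_mem (2 : κ)⁻¹ m2)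
    convert this using 1
    simp only [letterRel, a, z, hp, koszulSign_one_one, koszulSign_mul_self]
    match_scalars <;> field_simp <;> ring
  -- For the cube of an odd letter z with relation r, the left side of the syzygy is 3 (r z - z r),
  -- while the goal is half of r z - z r.
  · convert N.smul_mem ((2 : κ)⁻¹ * (3 : κ)⁻¹) hmem using 1
    simp only [letterRel, a, z, hp, koszulSign_one_one]
    match_scalars <;> field_simp <;> ring

end LieSuperalgebra

/-! ### Normal words and the PBW theorem -/

/-- The ordered word in which the letter `i` occurs `E i` times. -/
def expWord {n : ℕ} (E : Fin n → ℕ) : List (Fin n) :=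
  (List.ofFn fun i => List.replicate (E i) i).flatten

theorem count_expWord {n : ℕ} (E : Fin n → ℕ) (i : Fin n) : (expWord E).count i = E i := by
  simp [expWord, List.count_flatten, List.map_ofFn, List.sum_ofFn, Function.comp_def,
    List.count_replicate]

theorem length_expWord {n : ℕ} (E : Fin n → ℕ) : (expWord E).length = ∑ i, E i := by
  simp [expWord, List.length_flatten, List.map_ofFn, List.sum_ofFn, Function.comp_def]

theorem orderedMonomial_eq_prod_expWord {A : Type*} [Monoid A] {n : ℕ} (x : Fin n → A)
    (E : Fin n → ℕ) : orderedMonomial x E = ((expWord E).map x).prod := by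
  simp [orderedMonomial, expWord, List.map_flatten, List.prod_flatten, List.map_ofFn,
    Function.comp_def]

namespace LieSuperalgebra

variable {κ : Type*} {g : Type*} [Field κ] [AddCommGroup g] [Module κ g]
variable {L : LieSuperalgebra κ g} {n : ℕ} {e : Module.Basis (Fin n) κ g} {par : Fin n → ZMod 2}

/-- The length of the offset `M` between the two places decides: 0 gives the same reduction, 1 an
overlap, and 2 or more disjoint pairs. -/
theorem confluent_of_prefix (h2 : (2 : κ) ≠ 0) (h3 : (3 : κ) ≠ 0)
    (he : ∀ i, e i ∈ L.grade (par i)) {A M B B' : List (Fin n)} {i j k l : Fin n} {c d : κ}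
    (hc : Reducible κ par c i j) (hd : Reducible κ par d k l)
    (h : i :: j :: B = M ++ k :: l :: B') :
    c • (word e A * letterRel L e par i j * word e B) -
      d • (word e (A ++ M) * letterRel L e par k l * word e B') ∈
    lowerRel L e par (A ++ i :: j :: B) := by
  match M, h with
  | [], h =>
    simp only [List.nil_append, List.cons.injEq] at h
    obtain ⟨rfl, rfl, rfl⟩ := h
    have : c = d := by
      rcases hc with ⟨h, rfl⟩ | ⟨rfl, -, rfl⟩ <;> rcases hd with ⟨h', rfl⟩ | ⟨h', -, rfl⟩
      · rfl
      · exact absurd h' h.ne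
      · exact absurd h' (lt_irrefl _)
      · rfl
    simp [this]
  | [m], h =>
    simp only [List.cons_append, List.nil_append, List.cons.injEq] at h
    obtain ⟨rfl, rfl, rfl⟩ := h
    exact overlap_confluent h2 h3 he hc hd
  | m :: m' :: M, h =>
    simp only [List.cons_append, List.cons.injEq] at h
    obtain ⟨rfl, rfl, rfl⟩ := h
    exact disjoint_confluent h2 hc hd

theorem Reduction.confluent (h2 : (2 : κ) ≠ 0) (h3 : (3 : κ) ≠ 0)
    (he : ∀ i, e i ∈ L.grade (par i)) {w : List (Fin n)} {f f' : TensorAlgebra κ g}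
    (h : Reduction L e par w f) (h' : Reduction L e par w f') :
    f - f' ∈ lowerRel L e par w := by
  obtain ⟨A, B, i, j, c, hw, hr, rfl⟩ := h
  obtain ⟨A', B', i', j', c', hw', hr', rfl⟩ := h'
  rw [sub_sub_sub_cancel_left]
  rcases List.append_eq_append_iff.1 (hw.symm.trans hw') with ⟨M, rfl, hM⟩ | ⟨M, rfl, hM⟩
  · rw [← Submodule.neg_mem_iff, neg_sub, hw]
    exact confluent_of_prefix h2 h3 he hr hr' hM
  · rw [hw']
    exact confluent_of_prefix h2 h3 he hr' hr hM

/-- The relation between the successive letters of a normal word. -/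
def NormalPair (par : Fin n → ZMod 2) (i j : Fin n) : Prop :=
  i < j ∨ (i = j ∧ par i ≠ 1)

instance (par : Fin n → ZMod 2) : IsTrans (Fin n) (NormalPair par) where
  trans := by
    rintro a b c (h | ⟨rfl, h⟩) (h' | ⟨rfl, h'⟩)
    · exact Or.inl (h.trans h')
    · exact Or.inl h
    · exact Or.inl h'
    · exact Or.inr ⟨rfl, h⟩

theorem not_reduction_of_pairwise {w : List (Fin n)} (hw : w.Pairwise (NormalPair par))
    (f : TensorAlgebra κ g) : ¬ Reduction L e par w f := by
  rintro ⟨A, B, i, j, c, rfl, hr, -⟩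
  have hij : NormalPair par i j := by
    have := (List.pairwise_append.1 hw).2.1
    exact (List.pairwise_cons.1 this).1 j (by simp)
  rcases hij with h | ⟨rfl, h⟩ <;> rcases hr with ⟨h', -⟩ | ⟨h', h'', -⟩
  · exact absurd h' h.not_gt
  · exact absurd h' h.ne'
  · exact lt_irrefl _ h'
  · exact h h''

theorem exists_reduction_of_not_pairwise {w : List (Fin n)}
    (hw : ¬ w.Pairwise (NormalPair par)) : ∃ f, Reduction L e par w f := by
  rw [← List.isChain_iff_pairwise, List.isChain_iff_forall_rel_of_append_cons_cons] at hw
  push Not at hw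
  obtain ⟨i, j, A, B, rfl, h⟩ := hw
  rw [NormalPair, not_or, not_and, not_not, not_lt] at h
  rcases h.1.lt_or_eq with h' | h'
  · exact ⟨_, A, B, i, j, 1, rfl, Or.inl ⟨h', rfl⟩, rfl⟩
  · exact ⟨_, A, B, i, j, 2⁻¹, rfl, Or.inr ⟨h', h.2 h'.symm, rfl⟩, rfl⟩

theorem pairwise_expWord {E : Fin n → ℕ} (hE : ∀ i, par i = 1 → E i < 2) :
    (expWord E).Pairwise (NormalPair par) := by
  rw [expWord, List.pairwise_flatten]
  constructor
  · simp only [List.forall_mem_ofFn_iff, List.pairwise_replicate]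
    intro i
    by_cases h : par i = 1
    · exact Or.inl (by have := hE i h; omega)
    · exact Or.inr (Or.inr ⟨rfl, h⟩)
  · rw [List.pairwise_ofFn]
    intro i j hij x hx y hy
    rw [List.eq_of_mem_replicate hx, List.eq_of_mem_replicate hy]
    exact Or.inl hij

theorem eq_expWord_count {w : List (Fin n)} (hw : w.Pairwise (NormalPair par)) :
    w = expWord fun i => w.count i := by
  have hle : ∀ i j : Fin n, NormalPair par i j → i ≤ j := by
    rintro i j (h | ⟨rfl, -⟩)
    · exact h.le
    · exact le_rfl
  -- A sorted list is determined by its multiplicities. Taking all parities even makes the exponent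
  -- bound vacuous, leaving only sortedness of the word.
  refine List.Perm.eq_of_pairwise (le := (· ≤ ·)) (fun a b _ _ => le_antisymm) (hw.imp (hle _ _))
    ((pairwise_expWord (par := fun _ => 0) (by simp)).imp ?_)
    (List.perm_iff_count.2 fun i => by rw [count_expWord])
  rintro i j (h | ⟨rfl, -⟩)
  · exact h.le
  · exact le_rfl

theorem count_lt_two {w : List (Fin n)} (hw : w.Pairwise (NormalPair par)) {i : Fin n}
    (hi : par i = 1) : w.count i < 2 := by
  by_contra h
  have := hw.sublist (List.replicate_sublist_iff.2 (not_lt.1 h))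
  rcases (List.pairwise_cons.1 this).1 i (by simp) with h | ⟨-, h⟩
  · exact lt_irrefl _ h
  · exact h hi

theorem mkAlgHom_word (w : List (Fin n)) :
    RingQuot.mkAlgHom κ L.URel (word e w) = (w.map fun i => L.ιU (e i)).prod := by
  rw [word, map_list_prod, List.map_map]
  rfl

theorem ιU_mul_ιU {α β : ZMod 2} {a b : g} (ha : a ∈ L.grade α) (hb : b ∈ L.grade β) :
    L.ιU a * L.ιU b = L.ιU (L.bracket a b) + koszulSign κ α β • (L.ιU b * L.ιU a) := by
  have := RingQuot.mkAlgHom_rel κ (URel.mk (L := L) α β a b ha hb)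
  rw [map_mul, map_add, map_smul, map_mul] at this
  exact this

theorem mkAlgHom_commRel {α β : ZMod 2} {a b : g} (ha : a ∈ L.grade α) (hb : b ∈ L.grade β) :
    RingQuot.mkAlgHom κ L.URel (L.commRel α β a b) = 0 := by
  have := RingQuot.mkAlgHom_rel κ (URel.mk (L := L) α β a b ha hb)
  rw [commRel, sub_sub, map_sub, this, sub_eq_zero]
  congr 1
  rw [add_comm]
  rfl

theorem Reduction.mkAlgHom_eq (he : ∀ i, e i ∈ L.grade (par i)) {w : List (Fin n)}
    {f : TensorAlgebra κ g} (h : Reduction L e par w f) :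
    RingQuot.mkAlgHom κ L.URel f = RingQuot.mkAlgHom κ L.URel (word e w) := by
  obtain ⟨A, B, i, j, c, -, -, rfl⟩ := h
  simp only [map_sub, map_smul, map_mul, mkAlgHom_commRel (he i) (he j)]
  simp

/-- The words are spanned by the ordered monomials that are not longer. -/
theorem prod_mem_span_orderedMonomial (h2 : (2 : κ) ≠ 0) (he : ∀ i, e i ∈ L.grade (par i))
    (w : List (Fin n)) :
    (w.map fun i => L.ιU (e i)).prod ∈ Submodule.span κ {u | ∃ E : Fin n → ℕ,
      (∀ i, par i = 1 → E i < 2) ∧ ∑ i, E i ≤ w.length ∧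
        u = orderedMonomial (fun i => L.ιU (e i)) E} := by
  have wf : WellFounded (List.Shortlex ((· < ·) : Fin n → Fin n → Prop)) :=
    List.Shortlex.wf wellFounded_lt
  induction w using wf.induction with
  | _ w ih =>
    by_cases hw : w.Pairwise (NormalPair par)
    · have h := eq_expWord_count hw
      refine Submodule.subset_span ⟨_, fun i hi => count_lt_two hw hi, ?_, ?_⟩
      · rw [← length_expWord, ← h]
      · rw [orderedMonomial_eq_prod_expWord, ← h]
    · obtain ⟨f, hf⟩ := exists_reduction_of_not_pairwise (L := L) (e := e) hw
      rw [← mkAlgHom_word, ← hf.mkAlgHom_eq he]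
      have hle : lowerWord e w ≤ (Submodule.span κ {u | ∃ E : Fin n → ℕ,
          (∀ i, par i = 1 → E i < 2) ∧ ∑ i, E i ≤ w.length ∧
            u = orderedMonomial (fun i => L.ιU (e i)) E}).comap
          (RingQuot.mkAlgHom κ L.URel).toLinearMap := by
        rw [lowerWord, Submodule.span_le]
        rintro _ ⟨v, hv, rfl⟩
        rw [SetLike.mem_coe, Submodule.mem_comap, AlgHom.toLinearMap_apply, mkAlgHom_word]
        refine Submodule.span_mono ?_ (ih v hv)
        rintro _ ⟨E, h, h', rfl⟩
        refine ⟨E, h, h'.trans ?_, rfl⟩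
        rcases List.shortlex_def.1 hv with h | h
        · exact h.le
        · exact h.1.le
      exact hle (hf.mem_lowerWord h2)

theorem span_range_words_eq_top :
    Submodule.span κ (Set.range fun w : List (Fin n) => (w.map fun i => L.ιU (e i)).prod) = ⊤ := by
  obtain ⟨b, hb⟩ := exists_wordBasis e
  rw [eq_top_iff, ← (LinearMap.range_eq_top (f := (RingQuot.mkAlgHom κ L.URel).toLinearMap)).2
    (RingQuot.mkAlgHom_surjective κ L.URel), ← Submodule.map_top, ← b.span_eq, Submodule.map_span,
    ← Set.range_comp]
  refine Submodule.span_mono ?_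
  rintro _ ⟨w, rfl⟩
  refine ⟨w, ?_⟩
  change _ = RingQuot.mkAlgHom κ L.URel (b w)
  rw [hb, mkAlgHom_word]

/-- The normal form map descends to U(g) and sends each ordered monomial to its own word, since
normal words are irreducible; distinct words are independent. -/
theorem linearIndependent_orderedMonomial (h2 : (2 : κ) ≠ 0) (h3 : (3 : κ) ≠ 0)
    (he : ∀ i, e i ∈ L.grade (par i)) :
    LinearIndependent κ (fun E : {E : Fin n → ℕ // ∀ i, par i = 1 → E i < 2} =>
      orderedMonomial (fun i => L.ιU (e i)) E.1) := by
  obtain ⟨b, hb⟩ := exists_wordBasis e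
  have wf : WellFounded (List.Shortlex ((· < ·) : Fin n → Fin n → Prop)) :=
    List.Shortlex.wf wellFounded_lt
  obtain ⟨σ, hσ, hσ'⟩ := exists_normalForm b _ wf (Reduction L e par)
    (fun w f hf => by simpa only [hb, lowerWord] using hf.mem_lowerWord h2)
    (fun w f f' hf hf' => by
      simpa only [hb, lowerRel] using hf.confluent h2 h3 he hf')
  simp only [hb] at hσ hσ'
  have hker : ∀ w, lowerRel L e par w ≤ LinearMap.ker σ := by
    intro w
    rw [lowerRel, Submodule.span_le]
    rintro _ ⟨v, f, -, hf, rfl⟩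
    simp [hσ v f hf]
  -- Any word longer than both words of the relation serves as the upper bound.
  have hrel : ∀ i j A B, σ (word e A * letterRel L e par i j * word e B) = 0 := by
    intro i j A B
    exact hker _ (letterRel_mem_lowerRel h2 he
      (w := List.replicate (A.length + B.length + 3) i)
      (List.Shortlex.of_length_lt (by simp; omega)) (List.Shortlex.of_length_lt (by simp; omega)))
  have hcomm : ∀ {α β : ZMod 2} {u v : g}, u ∈ L.grade α → v ∈ L.grade β → ∀ x y,
      σ (x * L.commRel α β u v * y) = 0 := by
    intro α β u v hu hv x y
    have h1 : ∀ A B, σ (word e A * L.commRel α β u v * word e B) = 0 := fun A B =>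
      mem_of_basis_rel_mem (N := LinearMap.ker (σ ∘ₗ
        LinearMap.mulRight κ (word e B) ∘ₗ LinearMap.mulLeft κ (word e A))) he
        (fun i j => hrel i j A B) hu hv
    have hA : ∀ A, σ ∘ₗ LinearMap.mulLeft κ (word e A * L.commRel α β u v) = 0 := fun A =>
      b.ext fun B => by simpa [hb, mul_assoc] using h1 A B
    have h4 : σ ∘ₗ LinearMap.mulRight κ (L.commRel α β u v * y) = 0 := b.ext fun A => by
      simpa [hb, mul_assoc] using LinearMap.congr_fun (hA A) y
    simpa [mul_assoc] using LinearMap.congr_fun h4 x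
  obtain ⟨φ, hφ⟩ := RingQuot.exists_linearMap L.URel σ (by
    rintro _ _ ⟨α, β, a, b, ha, hb⟩ x y
    have := hcomm ha hb x y
    rw [← sub_eq_zero, ← map_sub, ← sub_mul, ← mul_sub, ← this, commRel, koszulSign, ← sub_sub,
      sub_right_comm])
  refine LinearIndependent.of_comp φ ?_
  have : (φ ∘ fun E : {E : Fin n → ℕ // ∀ i, par i = 1 → E i < 2} =>
      orderedMonomial (fun i => L.ιU (e i)) E.1) = b ∘ fun E => expWord E.1 := by
    funext E
    simp only [Function.comp_apply]
    rw [orderedMonomial_eq_prod_expWord, ← mkAlgHom_word, hφ, hb,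
      hσ' _ (not_reduction_of_pairwise (pairwise_expWord E.2))]
  rw [this]
  refine b.linearIndependent.comp _ fun E E' h => ?_
  ext i
  have := congrArg (List.count i) h
  simpa only [count_expWord] using this

/-- The Poincaré-Birkhoff-Witt theorem for Lie superalgebras. -/
theorem exists_pbwBasis (h2 : (2 : κ) ≠ 0) (h3 : (3 : κ) ≠ 0)
    (he : ∀ i, e i ∈ L.grade (par i)) :
    ∃ B : Module.Basis {E : Fin n → ℕ // ∀ i, par i = 1 → E i < 2} κ L.UEnv,
      ∀ E, B E = orderedMonomial (fun i => L.ιU (e i)) E.1 := by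
  refine ⟨Module.Basis.mk (linearIndependent_orderedMonomial h2 h3 he) ?_, fun E => Module.Basis.mk_apply _ _ E⟩
  rw [← span_range_words_eq_top (e := e), Submodule.span_le]
  rintro _ ⟨w, rfl⟩
  refine Submodule.span_mono ?_ (prod_mem_span_orderedMonomial h2 he w)
  rintro _ ⟨E, hE, -, rfl⟩
  exact ⟨⟨E, hE⟩, rfl⟩

end LieSuperalgebra

/-! ### Jacobson's formula in characteristic p -/

section Jacobson

open Polynomial

/-- As `p` divides `p.choose (m + 1)`, Pascal's rule makes neighbouring entries of row `p - 1`
negatives of each other. -/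
theorem cast_choose_sub_one {S : Type*} [Ring S] (p : ℕ) [CharP S p] (hp : p.Prime) (m : ℕ)
    (hm : m < p) : ((p - 1).choose m : S) = (-1) ^ m := by
  induction m with
  | zero => simp
  | succ m ih =>
    have h : p.choose (m + 1) = (p - 1).choose m + (p - 1).choose (m + 1) := by
      conv_lhs => rw [← Nat.sub_add_cancel hp.one_le]
      rw [Nat.choose_succ_succ]
    have h' : ((p.choose (m + 1) : ℕ) : S) = 0 :=
      (CharP.cast_eq_zero_iff S p _).2 (hp.dvd_choose_self (Nat.succ_ne_zero _) hm)
    rw [h, Nat.cast_add, ih (by omega)] at h'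
    rw [pow_succ, mul_neg, mul_one]
    exact eq_neg_of_add_eq_zero_right h'

theorem Commute.sub_pow_char_sub_one {S : Type*} [Ring S] (p : ℕ) [CharP S p] (hp : p.Prime)
    (hodd : Odd p) {x y : S} (h : Commute x y) :
    (x - y) ^ (p - 1) = ∑ i ∈ Finset.range p, x ^ i * y ^ (p - 1 - i) := by
  rw [sub_eq_add_neg, h.neg_right.add_pow, Nat.sub_add_cancel hp.one_le]
  refine Finset.sum_congr rfl fun i hi => ?_
  have hi' := Finset.mem_range.1 hi
  rw [cast_choose_sub_one p hp i hi', neg_pow y, mul_assoc, mul_assoc,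
    (((Commute.neg_one_left y).pow_pow i (p - 1 - i)).symm).eq, ← mul_assoc (_ ^ (p - 1 - i)),
    ← pow_add, Nat.sub_add_cancel (by omega), Even.neg_one_pow, one_mul]
  obtain ⟨k, rfl⟩ := hodd
  exact ⟨k, by omega⟩

theorem Polynomial.derivative_pow_eq_sum {A : Type*} [Ring A] (D : A[X]) (n : ℕ) :
    derivative (D ^ n) = ∑ i ∈ Finset.range n, D ^ i * derivative D * D ^ (n - 1 - i) := by
  induction n with
  | zero => simp
  | succ n ih =>
    rw [pow_succ, derivative_mul, ih, Finset.sum_range_succ, Finset.sum_mul]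
    congr 1
    · refine Finset.sum_congr rfl fun i hi => ?_
      have hi' := Finset.mem_range.1 hi
      rw [mul_assoc, ← pow_succ]
      congr 2
      omega
    · simp

variable {κ A : Type*} [Field κ] [Ring A] [Algebra κ A]

variable (κ) in
/-- The commutator with `u`, as a linear map. -/
noncomputable def commutatorEnd (u : A) : Module.End κ A :=
  LinearMap.mulLeft κ u - LinearMap.mulRight κ u

theorem commutatorEnd_apply (u v : A) : commutatorEnd κ u v = u * v - v * u := rfl

theorem charP_of_algebra [Nontrivial A] (p : ℕ) [CharP κ p] : CharP A p :=
  charP_of_injective_algebraMap (algebraMap κ A).injective p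

/-- Left and right multiplication by `u` commute, so Frobenius applies to their difference. -/
theorem commutatorEnd_pow_char (p : ℕ) [CharP κ p] (hp : p.Prime) (u : A) :
    commutatorEnd κ u ^ p = commutatorEnd κ (u ^ p) := by
  cases subsingleton_or_nontrivial A
  · exact Subsingleton.elim _ _
  have : CharP (Module.End κ A) p := charP_of_algebra (κ := κ) p
  have : Fact p.Prime := ⟨hp⟩
  rw [commutatorEnd, sub_pow_char_of_commute p (LinearMap.commute_mulLeft_right u u),
    LinearMap.pow_mulLeft, LinearMap.pow_mulRight]
  rfl

/-- The right side is the noncommutative derivative of `u ^ p` in the direction `v`, which links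
iterated commutators to `derivative_pow_eq_sum`. -/
theorem commutatorEnd_pow_char_sub_one (p : ℕ) [CharP κ p] (hp : p.Prime) (hodd : Odd p) (u v : A) :
    (commutatorEnd κ u ^ (p - 1)) v = ∑ i ∈ Finset.range p, u ^ i * v * u ^ (p - 1 - i) := by
  cases subsingleton_or_nontrivial A
  · exact Subsingleton.elim _ _
  have : CharP (Module.End κ A) p := charP_of_algebra (κ := κ) p
  rw [commutatorEnd, (LinearMap.commute_mulLeft_right u u).sub_pow_char_sub_one p hp hodd,
    LinearMap.sum_apply]
  refine Finset.sum_congr rfl fun i _ => ?_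
  rw [LinearMap.pow_mulLeft, LinearMap.pow_mulRight]
  simp [mul_assoc]

/-- The coefficients of a power of `xX + y` are determined by iterated commutators. -/
theorem coeff_commutatorEnd_pow (p : ℕ) [CharP κ p] (hp : p.Prime) (hodd : Odd p) (x y : A) (i : ℕ) :
    ((commutatorEnd κ (C x * X + C y) ^ (p - 1)) (C x)).coeff i =
      ((C x * X + C y) ^ p).coeff (i + 1) * (i + 1) := by
  rw [commutatorEnd_pow_char_sub_one p hp hodd, ← coeff_derivative, derivative_pow_eq_sum]
  simp

/-- Evaluation of `(xX + y) ^ p` at 1, which is central and so gives a ring homomorphism; the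
extreme coefficients are `y ^ p` and `x ^ p`. -/
theorem add_pow_eq_sum_coeff (x y : A) (p : ℕ) (hp : p ≠ 0) :
    (x + y) ^ p = x ^ p + y ^ p +
      ∑ i ∈ Finset.Icc 1 (p - 1), ((C x * X + C y) ^ p).coeff i := by
  set D : A[X] := C x * X + C y with hD
  let φ : A[X] →+* A := eval₂RingHom' (RingHom.id A) 1 fun a => Commute.one_right a
  have hφ : φ D = x + y := by
    change eval₂ (RingHom.id A) 1 (C x * X + C y) = x + y
    simp
  have hdeg : D.natDegree ≤ 1 := natDegree_linear_le
  have hsum : φ (D ^ p) = ∑ i ∈ Finset.range (p + 1), (D ^ p).coeff i := by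
    change eval 1 (D ^ p) = _
    rw [eval_eq_sum_range' (n := p + 1)]
    · simp
    · have := natDegree_pow_le_of_le p hdeg
      omega
  have h0 : (D ^ p).coeff 0 = y ^ p := by
    change constantCoeff (D ^ p) = _
    rw [map_pow]
    simp [hD]
  have h1 : (D ^ p).coeff p = x ^ p := by
    have := coeff_pow_of_natDegree_le (m := p) hdeg
    rw [mul_one] at this
    rw [this]
    simp [hD]
  rw [map_pow, hφ] at hsum
  obtain ⟨q, rfl⟩ := Nat.exists_eq_succ_of_ne_zero hp
  rw [hsum, Finset.sum_range_succ, h1, Finset.sum_range_succ', h0]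
  simp only [Nat.succ_eq_add_one, Nat.add_sub_cancel]
  rw [Finset.range_eq_Ico, Finset.sum_Ico_add' (fun i => (D ^ (q + 1)).coeff i), zero_add,
    Finset.Ico_add_one_right_eq_Icc]
  abel

end Jacobson

namespace LieSuperalgebra

open Polynomial

variable {κ : Type*} {g : Type*} [Field κ] [AddCommGroup g] [Module κ g]
variable {L : LieSuperalgebra κ g} {A : Type*} [Ring A] [Algebra κ A]

/-- Carries the coefficients that define `jacobsonTerm` from g to an associative algebra. Only
brackets with `a` and `b` need be commutators, as holds in U(g) for even `a` and `b`. -/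
theorem coeff_commutatorEnd_pow_eq (f : g →ₗ[κ] A) {a b : g}
    (ha : ∀ v, f (L.bracket a v) = f a * f v - f v * f a)
    (hb : ∀ v, f (L.bracket b v) = f b * f v - f v * f b) (v : g) (m k : ℕ) :
    ((commutatorEnd κ (C (f a) * X + C (f b)) ^ m) (C (f v))).coeff k =
      f (((X * C (L.ad a) + C (L.ad b)) ^ m).coeff k v) := by
  induction m generalizing k with
  | zero =>
    simp only [pow_zero, Module.End.one_apply, coeff_C, coeff_one]
    split_ifs <;> simp
  | succ m ih =>
    rw [pow_succ', pow_succ', Module.End.mul_apply, commutatorEnd_apply]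
    have h1 : ∀ h : A[X], (C (f a) * X + C (f b)) * h - h * (C (f a) * X + C (f b)) =
        C (f a) * (X * h) - h * C (f a) * X + (C (f b) * h - h * C (f b)) := fun h => by
      noncomm_ring
    rw [h1, add_mul, mul_assoc X]
    cases k with
    | zero =>
      simp only [coeff_add, coeff_sub, coeff_C_mul, coeff_mul_C, coeff_X_mul_zero,
        coeff_mul_X_zero, ih, LinearMap.add_apply, Module.End.mul_apply, map_add]
      simp [ad, hb]
    | succ k =>
      simp only [coeff_add, coeff_sub, coeff_C_mul, coeff_mul_C, coeff_X_mul,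
        coeff_mul_X, ih, LinearMap.add_apply, Module.End.mul_apply, map_add]
      simp [ad, ha, hb]

/-- Jacobson's formula for the `p`-th power of a sum. -/
theorem add_pow_char_eq (p : ℕ) [CharP κ p] (hp : p.Prime) (hodd : Odd p) (f : g →ₗ[κ] A) {a b : g}
    (ha : ∀ v, f (L.bracket a v) = f a * f v - f v * f a)
    (hb : ∀ v, f (L.bracket b v) = f b * f v - f v * f b) :
    (f a + f b) ^ p = f a ^ p + f b ^ p +
      f (∑ i ∈ Finset.Icc 1 (p - 1), L.jacobsonTerm p i a b) := by
  rw [add_pow_eq_sum_coeff _ _ _ hp.ne_zero, map_sum]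
  congr 1
  refine Finset.sum_congr rfl fun i hi => ?_
  rw [Finset.mem_Icc] at hi
  obtain ⟨j, rfl⟩ := Nat.exists_eq_add_of_le' hi.1
  have hj : ((j + 1 : ℕ) : κ) ≠ 0 := fun h =>
    Nat.not_dvd_of_pos_of_lt (Nat.succ_pos j) (by omega) ((CharP.cast_eq_zero_iff κ p _).1 h)
  rw [jacobsonTerm, map_smul, Nat.add_sub_cancel, ← coeff_commutatorEnd_pow_eq f ha hb,
    coeff_commutatorEnd_pow p hp hodd, eq_inv_smul_iff₀ hj, Algebra.smul_def]
  rw [map_natCast (algebraMap κ A), (Nat.cast_commute (j + 1) _).eq]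
  push_cast
  rfl

theorem ιU_bracket_even {a : g} (ha : a ∈ L.grade 0) (v : g) :
    L.ιU (L.bracket a v) = L.ιU a * L.ιU v - L.ιU v * L.ιU a := by
  have hv : v ∈ ⨆ i, L.grade i := by
    rw [L.isInternal.submodule_iSup_eq_top]
    trivial
  induction hv using Submodule.iSup_induction' with
  | mem i x hx => rw [ιU_mul_ιU ha hx, koszulSign_zero_left, one_smul, add_sub_cancel_right]
  | zero => simp
  | add x y _ _ hx hy =>
    rw [map_add, map_add, hx, hy, map_add]
    noncomm_ring

end LieSuperalgebra

/-! ### Central elements and the restricted PBW theorem -/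

/-- A family that agrees with a basis up to terms of lower degree is a basis. -/
theorem Module.Basis.exists_of_triangular {X κ M : Type*} [Field κ] [AddCommGroup M] [Module κ M]
    (b : Module.Basis X κ M) (deg : X → ℕ) (v : X → M)
    (h : ∀ i, v i - b i ∈ Submodule.span κ {m | ∃ j, deg j < deg i ∧ m = b j}) :
    ∃ b' : Module.Basis X κ M, ∀ i, b' i = v i := by
  let D : ℕ → Submodule κ M := fun d => Submodule.span κ {m | ∃ j, deg j < d ∧ m = b j}
  have hmono : ∀ {d d'}, d ≤ d' → D d ≤ D d' := fun hd => Submodule.span_mono (by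
    rintro _ ⟨j, hj, rfl⟩
    exact ⟨j, hj.trans_le hd, rfl⟩)
  let φ : M →ₗ[κ] M := b.constr κ v
  have hφ : ∀ i, φ (b i) = v i := fun i => b.constr_basis κ v i
  -- `φ` is the identity plus a degree-lowering map, so both injectivity and surjectivity follow by
  -- induction on the degree.
  have hlow : ∀ d u, u ∈ D (d + 1) → φ u - u ∈ D d := by
    intro d u hu
    induction hu using Submodule.span_induction with
    | mem x hx =>
      obtain ⟨j, hj, rfl⟩ := hx
      rw [hφ]
      exact hmono (Nat.lt_succ_iff.1 hj) (h j)
    | zero => simp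
    | add x y _ _ hx hy =>
      rw [map_add, add_sub_add_comm]
      exact add_mem hx hy
    | smul c x _ hx =>
      rw [map_smul, ← smul_sub]
      exact Submodule.smul_mem _ _ hx
  have hD0 : ∀ u ∈ D 0, u = 0 := by
    intro u hu
    simpa [D] using hu
  have hex : ∀ u, ∃ d, u ∈ D d := by
    intro u
    induction b.mem_span u using Submodule.span_induction with
    | mem x hx =>
      obtain ⟨j, rfl⟩ := hx
      exact ⟨deg j + 1, Submodule.subset_span ⟨j, Nat.lt_succ_self _, rfl⟩⟩
    | zero => exact ⟨0, zero_mem _⟩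
    | add x y _ _ hx hy =>
      obtain ⟨d, hd⟩ := hx
      obtain ⟨d', hd'⟩ := hy
      exact ⟨max d d', add_mem (hmono (le_max_left _ _) hd) (hmono (le_max_right _ _) hd')⟩
    | smul c x _ hx =>
      obtain ⟨d, hd⟩ := hx
      exact ⟨d, Submodule.smul_mem _ _ hd⟩
  have hinj : ∀ d u, u ∈ D d → φ u = 0 → u = 0 := by
    intro d
    induction d with
    | zero => exact fun u hu _ => hD0 u hu
    | succ d ih =>
      intro u hu h0
      refine ih u ?_ h0
      have := hlow d u hu
      rwa [h0, zero_sub, Submodule.neg_mem_iff] at this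
  have hsurj : ∀ d u, u ∈ D d → u ∈ LinearMap.range φ := by
    intro d
    induction d with
    | zero => intro u hu; rw [hD0 u hu]; exact zero_mem _
    | succ d ih =>
      intro u hu
      have := sub_mem (LinearMap.mem_range_self φ u) (ih _ (hlow d u hu))
      rwa [sub_sub_cancel] at this
  have hbij : Function.Bijective φ := by
    constructor
    · rw [← LinearMap.ker_eq_bot, LinearMap.ker_eq_bot']
      intro u hu
      obtain ⟨d, hd⟩ := hex u
      exact hinj d u hd hu
    · rw [← LinearMap.range_eq_top, eq_top_iff]
      intro u _
      obtain ⟨d, hd⟩ := hex u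
      exact hsurj d u hd
  exact ⟨b.map (LinearEquiv.ofBijective φ hbij), fun i => by simp [hφ]⟩

theorem List.prod_map_eq_mul_of_commute {ι A : Type*} [Monoid A] [DecidableEq ι] {l : List ι}
    (hl : l.Nodup) {i : ι} (hi : i ∈ l) {f f' : ι → A} {z : A} (hz : ∀ a, Commute z a)
    (hf : ∀ j, j ≠ i → f' j = f j) (hfi : f' i = z * f i) :
    (l.map f').prod = z * (l.map f).prod := by
  induction l with
  | nil => simp at hi
  | cons j l ih =>
    rw [List.map_cons, List.prod_cons, List.map_cons, List.prod_cons]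
    rw [List.nodup_cons] at hl
    by_cases h : j = i
    · subst h
      have : l.map f' = l.map f := List.map_congr_left fun k hk => hf k fun h => hl.1 (h ▸ hk)
      rw [this, hfi, mul_assoc]
    · have hi' : i ∈ l := (List.mem_cons.1 hi).resolve_left (Ne.symm h)
      rw [hf j h, ih hl.2 hi', ← mul_assoc, ← mul_assoc, (hz _).eq]

namespace LieSuperalgebra

variable {κ : Type*} {g : Type*} [Field κ] [AddCommGroup g] [Module κ g]
variable {L : LieSuperalgebra κ g} {n : ℕ} {e : Module.Basis (Fin n) κ g} {par : Fin n → ZMod 2}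

variable (L e) in
/-- The span of the products of less than `d` basis elements. -/
noncomputable def lengthFiltration (d : ℕ) : Submodule κ L.UEnv :=
  Submodule.span κ {u | ∃ w : List (Fin n), w.length < d ∧
    u = (w.map fun i => L.ιU (e i)).prod}

theorem lengthFiltration_mono {d d' : ℕ} (h : d ≤ d') :
    lengthFiltration L e d ≤ lengthFiltration L e d' :=
  Submodule.span_mono (by
    rintro _ ⟨w, hw, rfl⟩
    exact ⟨w, hw.trans_le h, rfl⟩)

/-- The index bounds lengths strictly: lengths at most `m - 1` and `k - 1` add up to less than `N`.
-/
theorem mul_mem_lengthFiltration {m k N : ℕ} (h : m + k ≤ N + 1) {a b : L.UEnv}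
    (ha : a ∈ lengthFiltration L e m) (hb : b ∈ lengthFiltration L e k) :
    a * b ∈ lengthFiltration L e N := by
  have : a * b ∈ lengthFiltration L e m * lengthFiltration L e k := Submodule.mul_mem_mul ha hb
  rw [lengthFiltration, lengthFiltration, Submodule.span_mul_span] at this
  refine Submodule.span_mono ?_ this
  rintro _ ⟨_, ⟨w, hw, rfl⟩, _, ⟨w', hw', rfl⟩, rfl⟩
  exact ⟨w ++ w', by rw [List.length_append]; omega, by simp⟩

theorem ιU_mem_lengthFiltration (u : g) : L.ιU u ∈ lengthFiltration L e 2 := by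
  have h : ∀ i, e i ∈ (lengthFiltration L e 2).comap L.ιU := fun i =>
    Submodule.subset_span ⟨[i], by simp, by simp⟩
  have := Submodule.span_le.2 (Set.range_subset_iff.2 h)
  rw [e.span_eq] at this
  exact this trivial

variable (L e) in
/-- `a` and `b` have degree at most `m`, and the same leading term. -/
def LeadingEq (m : ℕ) (a b : L.UEnv) : Prop :=
  a ∈ lengthFiltration L e (m + 1) ∧ b ∈ lengthFiltration L e (m + 1) ∧
    a - b ∈ lengthFiltration L e m

theorem LeadingEq.mul {m k : ℕ} {a b c d : L.UEnv} (h : LeadingEq L e m a b)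
    (h' : LeadingEq L e k c d) : LeadingEq L e (m + k) (a * c) (b * d) := by
  refine ⟨mul_mem_lengthFiltration (by omega) h.1 h'.1,
    mul_mem_lengthFiltration (by omega) h.2.1 h'.2.1, ?_⟩
  have : a * c - b * d = (a - b) * c + b * (c - d) := by
    rw [sub_mul, mul_sub]
    abel
  rw [this]
  exact add_mem (mul_mem_lengthFiltration (by omega) h.2.2 h'.1)
    (mul_mem_lengthFiltration (by omega) h.2.1 h'.2.2)

theorem LeadingEq.one : LeadingEq L e 0 1 1 := by
  have : (1 : L.UEnv) ∈ lengthFiltration L e (0 + 1) :=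
    Submodule.subset_span ⟨[], by simp, by simp⟩
  exact ⟨this, this, by simp⟩

theorem LeadingEq.pow {m : ℕ} {a b : L.UEnv} (h : LeadingEq L e m a b) (k : ℕ) :
    LeadingEq L e (m * k) (a ^ k) (b ^ k) := by
  induction k with
  | zero => simpa using LeadingEq.one
  | succ k ih => rw [pow_succ, pow_succ, Nat.mul_succ]; exact ih.mul h

theorem LeadingEq.list_prod {ι : Type*} (l : List ι) {m : ι → ℕ} {a b : ι → L.UEnv}
    (h : ∀ i, LeadingEq L e (m i) (a i) (b i)) :
    LeadingEq L e (l.map m).sum (l.map a).prod (l.map b).prod := by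
  induction l with
  | nil => simpa using LeadingEq.one
  | cons i l ih => simpa using (h i).mul ih

theorem LeadingEq.letter (i : Fin n) : LeadingEq L e 1 (L.ιU (e i)) (L.ιU (e i)) :=
  ⟨ιU_mem_lengthFiltration _, ιU_mem_lengthFiltration _, by simp⟩

variable {p : ℕ} {pm : L.grade 0 → L.grade 0}

variable (pm) in
/-- The element `a ^ p - a^[p]` of the enveloping algebra. -/
noncomputable def pCentral (p : ℕ) (a : L.grade 0) : L.UEnv :=
  L.ιU (a : g) ^ p - L.ιU (pm a : g)

/-- In U(g), ad(a)^p = ad(a^p) by Frobenius, while the restricted structure gives ad(a)^p =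
ad(a^[p]) on g; so the difference commutes with the generators. -/
theorem commute_pCentral (e : Module.Basis (Fin n) κ g) [CharP κ p] (hp : p.Prime)
    (hpm : L.IsPMap p pm) (a : L.grade 0) (u : L.UEnv) : Commute (pCentral pm p a) u := by
  have hpow : ∀ (m : ℕ) (v : g),
      (commutatorEnd κ (L.ιU a) ^ m) (L.ιU v) = L.ιU ((L.ad a ^ m) v) := by
    intro m
    induction m with
    | zero => simp
    | succ m ih =>
      intro v
      rw [pow_succ', pow_succ', Module.End.mul_apply, ih, commutatorEnd_apply,
        ← ιU_bracket_even a.2]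
      rfl
  have hι : ∀ v, Commute (pCentral pm p a) (L.ιU v) := by
    intro v
    have := hpow p v
    rw [commutatorEnd_pow_char p hp, ← hpm.ad_pow, ιU_bracket_even (pm a).2,
      commutatorEnd_apply] at this
    rw [Commute, SemiconjBy, pCentral, sub_mul, mul_sub, sub_eq_sub_iff_sub_eq_sub, this]
  have hu : u ∈ Submodule.span κ
      (Set.range fun w : List (Fin n) => (w.map fun i => L.ιU (e i)).prod) := by
    rw [span_range_words_eq_top]; trivial
  induction hu using Submodule.span_induction with
  | mem x hx =>
    obtain ⟨w, rfl⟩ := hx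
    refine Commute.list_prod_right _ _ fun y hy => ?_
    obtain ⟨i, -, rfl⟩ := List.mem_map.1 hy
    exact hι _
  | zero => exact Commute.zero_right _
  | add x y _ _ hx hy => exact hx.add_right hy
  | smul c x _ hx => exact hx.smul_right c

/-- The Jacobson terms of (a + b)^p and of (a + b)^[p] cancel. -/
theorem pCentral_add [CharP κ p] (hp : p.Prime) (hodd : Odd p) (hpm : L.IsPMap p pm)
    (a b : L.grade 0) : pCentral pm p (a + b) = pCentral pm p a + pCentral pm p b := by
  rw [pCentral, hpm.add, Submodule.coe_add, map_add, add_pow_char_eq p hp hodd L.ιU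
    (ιU_bracket_even a.2) (ιU_bracket_even b.2), map_add, map_add, pCentral, pCentral]
  abel

theorem pCentral_smul (hpm : L.IsPMap p pm) (c : κ) (a : L.grade 0) :
    pCentral pm p (c • a) = c ^ p • pCentral pm p a := by
  rw [pCentral, hpm.smul, Submodule.coe_smul, Submodule.coe_smul, map_smul, map_smul, smul_pow,
    pCentral, smul_sub]

/-- The ideal generated by the elements `a ^ p - a^[p]` is generated by those where `a` is a basis
element. -/
theorem map_mul_pCentral_mul_eq_zero [CharP κ p] (hp : p.Prime) (hodd : Odd p)
    (hpm : L.IsPMap p pm) (he : ∀ i, e i ∈ L.grade (par i)) {M : Type*} [AddCommGroup M]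
    [Module κ M] (π : L.UEnv →ₗ[κ] M)
    (h : ∀ i (hi : par i = 0) x y, π (x * pCentral pm p ⟨e i, hi ▸ he i⟩ * y) = 0)
    (a : L.grade 0) (x y : L.UEnv) : π (x * pCentral pm p a * y) = 0 := by
  -- The zero locus of a p-semilinear map is a subspace, so the even basis vectors suffice.
  let S : Submodule κ (L.grade 0) :=
    { carrier := {a | π (x * pCentral pm p a * y) = 0}
      zero_mem' := by
        have := pCentral_smul hpm 0 0
        rw [zero_smul, zero_pow hp.ne_zero, zero_smul] at this
        simp [this]
      add_mem' := fun {a b} ha hb => by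
        simp only [Set.mem_ofPred_eq] at ha hb ⊢
        rw [pCentral_add hp hodd hpm, mul_add, add_mul, map_add, ha, hb, add_zero]
      smul_mem' := fun c a ha => by
        simp only [Set.mem_ofPred_eq] at ha ⊢
        rw [pCentral_smul hpm, mul_smul_comm, smul_mul_assoc, map_smul, ha, smul_zero] }
  have hle : Submodule.span κ {b | ∃ i, par i = 0 ∧ b = e i} ≤ S.map (L.grade 0).subtype := by
    rw [Submodule.span_le]
    rintro _ ⟨i, hi, rfl⟩
    exact ⟨⟨e i, hi ▸ he i⟩, h i hi x y, rfl⟩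
  obtain ⟨b, hb, hba⟩ := hle (L.mem_span_of_mem_grade e par he a.2)
  rw [← (Subtype.ext hba : b = a)]
  exact hb

/-- A basis of the enveloping algebra adapted to the central elements `a ^ p - a^[p]`. -/
theorem exists_pCentralBasis (h2 : (2 : κ) ≠ 0) (h3 : (3 : κ) ≠ 0) (hp : 2 ≤ p)
    (he : ∀ i, e i ∈ L.grade (par i)) (d : Fin n → g) :
    ∃ B : Module.Basis {E : Fin n → ℕ // ∀ i, par i = 1 → E i < 2} κ L.UEnv,
      ∀ E, B E = ((List.finRange n).map fun i =>
        L.ιU (e i) ^ (E.1 i % p) * (L.ιU (e i) ^ p - L.ιU (d i)) ^ (E.1 i / p)).prod := by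
  obtain ⟨B, hB⟩ := exists_pbwBasis h2 h3 he
  refine B.exists_of_triangular (fun E => ∑ i, E.1 i) _ fun E => ?_
  -- The correction `d i` has degree 1, which is below `p`, so it does not affect the leading term.
  have hξ : ∀ i, LeadingEq L e p (L.ιU (e i) ^ p - L.ιU (d i)) (L.ιU (e i) ^ p) := by
    intro i
    have h1 : LeadingEq L e p (L.ιU (e i) ^ p) (L.ιU (e i) ^ p) := by
      simpa using (LeadingEq.letter i).pow p
    have h2 : L.ιU (d i) ∈ lengthFiltration L e p :=
      lengthFiltration_mono hp (ιU_mem_lengthFiltration _)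
    refine ⟨sub_mem h1.1 (lengthFiltration_mono (Nat.le_succ p) h2), h1.1, ?_⟩
    rw [sub_sub_cancel_left]
    exact neg_mem h2
  have hi : ∀ i, LeadingEq L e (E.1 i)
      (L.ιU (e i) ^ (E.1 i % p) * (L.ιU (e i) ^ p - L.ιU (d i)) ^ (E.1 i / p))
      (L.ιU (e i) ^ E.1 i) := by
    intro i
    have := ((LeadingEq.letter i).pow (E.1 i % p)).mul ((hξ i).pow (E.1 i / p))
    rwa [← pow_mul, ← pow_add, one_mul, Nat.mod_add_div] at this
  have := (LeadingEq.list_prod (List.finRange n) hi).2.2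
  rw [hB, orderedMonomial, List.ofFn_eq_map]
  have hsum : ((List.finRange n).map fun i => E.1 i).sum = ∑ i, E.1 i := by
    rw [← List.ofFn_eq_map, List.sum_ofFn]
  rw [hsum] at this
  refine (?_ : lengthFiltration L e (∑ i, E.1 i) ≤ _) this
  rw [lengthFiltration, Submodule.span_le]
  rintro _ ⟨w, hw, rfl⟩
  refine Submodule.span_mono ?_ (prod_mem_span_orderedMonomial h2 he w)
  rintro _ ⟨E', hE', hlen, rfl⟩
  exact ⟨⟨E', hE'⟩, hlen.trans_lt hw, (hB ⟨E', hE'⟩).symm⟩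

/-- The Poincaré-Birkhoff-Witt theorem for restricted Lie superalgebras. -/
theorem exists_restrictedPbwBasis [CharP κ p] (hp : p.Prime) (hp3 : 3 < p)
    (h2 : (2 : κ) ≠ 0) (h3 : (3 : κ) ≠ 0) (hpm : L.IsPMap p pm)
    (he : ∀ i, e i ∈ L.grade (par i)) :
    ∃ B : Module.Basis {E : Fin n → ℕ // (∀ i, par i = 1 → E i < 2) ∧ ∀ i, par i = 0 → E i < p}
      κ (L.REnv p pm), ∀ E, B E = orderedMonomial (fun i => L.ιR p pm (e i)) E.1 := by
  classical
  have hodd : Odd p := hp.odd_of_ne_two (by omega)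
  -- The default 0 at odd letters is harmless: their exponents are below 2 < p, so the corresponding
  -- factor has exponent 0.
  let d : Fin n → g := fun i => if h : par i = 0 then pm ⟨e i, h ▸ he i⟩ else 0
  have hd : ∀ i (h : par i = 0), L.ιU (e i) ^ p - L.ιU (d i) = pCentral pm p ⟨e i, h ▸ he i⟩ := by
    intro i h
    simp only [d, dif_pos h, pCentral]
  obtain ⟨V, hV⟩ := exists_pCentralBasis h2 h3 hp.two_le he d
  have hVmon : ∀ E : {E : Fin n → ℕ // (∀ i, par i = 1 → E i < 2) ∧ ∀ i, par i = 0 → E i < p},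
      V ⟨E.1, E.2.1⟩ = orderedMonomial (fun i => L.ιU (e i)) E.1 := by
    intro E
    rw [hV, orderedMonomial, List.ofFn_eq_map]
    congr 1
    refine List.map_congr_left fun i _ => ?_
    have : E.1 i < p := by
      rcases parity_cases (par i) with h | h
      · exact E.2.2 i h
      · have := E.2.1 i h
        omega
    simp only [Nat.mod_eq_of_lt this, Nat.div_eq_of_lt this, pow_zero, mul_one]
  have hmk : ∀ E : Fin n → ℕ, RingQuot.mkAlgHom κ (L.RRel p pm)
      (orderedMonomial (fun i => L.ιU (e i)) E) =
        orderedMonomial (fun i => L.ιR p pm (e i)) E := by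
    intro E
    rw [orderedMonomial, orderedMonomial, map_list_prod, List.map_ofFn]
    congr 2
    funext i
    simp only [Function.comp_apply, map_pow]
    rfl
  -- `π` forgets the basis vectors divisible by some ξ_i. It kills the ideal because multiplication
  -- by ξ_i sends each basis vector to one with i-th exponent at least `p`.
  let π : L.UEnv →ₗ[κ]
      ({E : Fin n → ℕ // (∀ i, par i = 1 → E i < 2) ∧ ∀ i, par i = 0 → E i < p} →₀ κ) :=
    V.constr κ fun E => if h : ∀ i, par i = 0 → E.1 i < p then
      Finsupp.single ⟨E.1, E.2, h⟩ 1 else 0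
  have hπ : ∀ E, π (V E) = if h : ∀ i, par i = 0 → E.1 i < p then
      Finsupp.single ⟨E.1, E.2, h⟩ 1 else 0 := fun E => V.constr_basis κ _ E
  have hπξ : ∀ i (hi : par i = 0) x y, π (x * pCentral pm p ⟨e i, hi ▸ he i⟩ * y) = 0 := by
    intro i hi x y
    have hcomm := commute_pCentral e hp hpm ⟨e i, hi ▸ he i⟩
    have h0 : π ∘ₗ LinearMap.mulLeft κ (pCentral pm p ⟨e i, hi ▸ he i⟩) = 0 := by
      refine V.ext fun E => ?_
      have hE : ∀ j, par j = 1 → Function.update E.1 i (E.1 i + p) j < 2 := by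
        intro j hj
        rw [Function.update_of_ne]
        · exact E.2 j hj
        · rintro rfl
          rw [hi] at hj
          exact absurd hj (by decide)
      have : pCentral pm p ⟨e i, hi ▸ he i⟩ * V E = V ⟨_, hE⟩ := by
        rw [hV, hV]
        symm
        refine List.prod_map_eq_mul_of_commute (List.nodup_finRange n) (List.mem_finRange i)
          hcomm (fun j hj => ?_) ?_
        · simp only [Function.update_of_ne hj]
        · simp only [Function.update_self, Nat.add_mod_right, Nat.add_div_right _ hp.pos]
          rw [hd i hi, pow_succ', ← mul_assoc, ← mul_assoc, (hcomm _).eq]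
      rw [LinearMap.comp_apply, LinearMap.mulLeft_apply, this, hπ, dif_neg, LinearMap.zero_apply]
      intro h
      have := h i hi
      simp at this
    rw [← (hcomm x).eq, mul_assoc]
    exact LinearMap.congr_fun h0 (x * y)
  obtain ⟨φ, hφ⟩ := RingQuot.exists_linearMap (L.RRel p pm) π (by
    rintro _ _ ⟨a⟩ x y
    rw [← sub_eq_zero, ← map_sub, ← sub_mul, ← mul_sub]
    exact map_mul_pCentral_mul_eq_zero hp hodd hpm he π hπξ a x y)
  have hli : LinearIndependent κ (fun E : {E : Fin n → ℕ //
      (∀ i, par i = 1 → E i < 2) ∧ ∀ i, par i = 0 → E i < p} =>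
        orderedMonomial (fun i => L.ιR p pm (e i)) E.1) := by
    refine LinearIndependent.of_comp φ ?_
    have : (φ ∘ fun E : {E : Fin n → ℕ //
        (∀ i, par i = 1 → E i < 2) ∧ ∀ i, par i = 0 → E i < p} =>
          orderedMonomial (fun i => L.ιR p pm (e i)) E.1) = fun E => Finsupp.single E 1 := by
      funext E
      rw [Function.comp_apply, ← hmk, ← hVmon, hφ, hπ, dif_pos E.2.2]
    rw [this]
    exact Finsupp.linearIndependent_single_one κ _
  refine ⟨Module.Basis.mk hli ?_, fun E => Module.Basis.mk_apply _ _ E⟩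
  have htop : Submodule.map (RingQuot.mkAlgHom κ (L.RRel p pm)).toLinearMap ⊤ = ⊤ := by
    rw [Submodule.map_top, LinearMap.range_eq_top]
    exact RingQuot.mkAlgHom_surjective κ _
  rw [← htop, ← V.span_eq, Submodule.map_span, Submodule.span_le]
  rintro _ ⟨_, ⟨E, rfl⟩, rfl⟩
  change RingQuot.mkAlgHom κ (L.RRel p pm) (V E) ∈ _
  by_cases h : ∀ i, par i = 0 → E.1 i < p
  · rw [hVmon ⟨E.1, E.2, h⟩, hmk]
    exact Submodule.subset_span ⟨⟨E.1, E.2, h⟩, rfl⟩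
  · push Not at h
    obtain ⟨i, hi, hEi⟩ := h
    -- An even exponent of at least `p` leaves a positive power of ξ_i in the product.
    have : RingQuot.mkAlgHom κ (L.RRel p pm) (V E) = 0 := by
      rw [hV, map_list_prod, List.map_map]
      refine List.prod_eq_zero (List.mem_map.2 ⟨i, List.mem_finRange i, ?_⟩)
      have hrel : RingQuot.mkAlgHom κ (L.RRel p pm) (pCentral pm p ⟨e i, hi ▸ he i⟩) = 0 := by
        rw [pCentral, map_sub, sub_eq_zero]
        exact RingQuot.mkAlgHom_rel κ (RRel.mk _)
      rw [Function.comp_apply, hd i hi, map_mul, map_pow _ _ (E.1 i / p), hrel,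
        zero_pow (Nat.div_pos hEi hp.pos).ne', mul_zero]
    rw [this]
    exact zero_mem _

end LieSuperalgebra

/-! ### Trading the z_j for squares of the x_j -/

theorem List.exists_smul_prod_map {κ A ι : Type*} [Field κ] [Ring A] [Algebra κ A] (l : List ι)
    {a b : ι → A} (h : ∀ i, ∃ c : κ, c ≠ 0 ∧ a i = c • b i) :
    ∃ c : κ, c ≠ 0 ∧ (l.map a).prod = c • (l.map b).prod := by
  induction l with
  | nil => exact ⟨1, one_ne_zero, by simp⟩
  | cons i l ih =>
    obtain ⟨c, hc, hl⟩ := ih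
    obtain ⟨d, hd, hi⟩ := h i
    exact ⟨d * c, mul_ne_zero hd hc, by simp [hl, hi, smul_smul, mul_comm]⟩

/-- The letters `x_j`, the squares `z_j` of those `x_j` with `s₁ ≤ j`, and the letters `y_k`. -/
abbrev Letter (s s₁ t₁ : ℕ) : Type := Fin s ⊕ {j : Fin s // s₁ ≤ (j : ℕ)} ⊕ Fin t₁

namespace Letter

variable {s s₁ t₁ : ℕ}

/-- The letter `x_j`, followed by `z_j` if there is one. -/
def block (t₁ : ℕ) (j : Fin s) : List (Letter s s₁ t₁) :=
  if h : s₁ ≤ (j : ℕ) then [Sum.inl j, Sum.inr (Sum.inl ⟨j, h⟩)] else [Sum.inl j]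

variable (s s₁ t₁) in
/-- The letters, in an order in which each `z_j` follows `x_j` immediately. -/
def enum : List (Letter s s₁ t₁) :=
  ((List.finRange s).map (block t₁)).flatten ++
    (List.finRange t₁).map fun k => Sum.inr (Sum.inr k)

theorem nodup_enum : (enum s s₁ t₁).Nodup := by
  have hmem : ∀ (j : Fin s) l, l ∈ block (s₁ := s₁) t₁ j →
      l = Sum.inl j ∨ ∃ h, l = Sum.inr (Sum.inl ⟨j, h⟩) := by
    intro j l hl
    unfold block at hl
    split_ifs at hl with h
    · simp only [List.mem_cons, List.not_mem_nil, or_false] at hl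
      exact hl.imp_right fun h' => ⟨h, h'⟩
    · exact Or.inl (by simpa using hl)
  rw [enum, List.nodup_append']
  refine ⟨?_, (List.nodup_finRange t₁).map fun a b h => by simpa using h, ?_⟩
  · rw [List.nodup_flatten]
    constructor
    · intro l hl
      obtain ⟨j, -, rfl⟩ := List.mem_map.1 hl
      unfold block
      split_ifs <;> simp
    · rw [List.pairwise_map]
      refine (List.nodup_finRange s).imp fun {i j} hij l hi hj => ?_
      rcases hmem i l hi with rfl | ⟨h, rfl⟩ <;> rcases hmem j _ hj with h' | ⟨h', h''⟩ <;>
        simp_all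
  · intro l hl hl'
    obtain ⟨k, -, rfl⟩ := List.mem_map.1 hl'
    obtain ⟨_, hb, hl⟩ := List.mem_flatten.1 hl
    obtain ⟨j, -, rfl⟩ := List.mem_map.1 hb
    rcases hmem j _ hl with h | ⟨h, h'⟩ <;> simp_all

theorem mem_enum (l : Letter s s₁ t₁) : l ∈ enum s s₁ t₁ := by
  rw [enum, List.mem_append, List.mem_flatten]
  rcases l with j | j | k
  · refine Or.inl ⟨_, List.mem_map.2 ⟨j, List.mem_finRange j, rfl⟩, ?_⟩
    unfold block
    split_ifs <;> simp
  · refine Or.inl ⟨_, List.mem_map.2 ⟨j, List.mem_finRange j.1, rfl⟩, ?_⟩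
    unfold block
    rw [dif_pos j.2]
    simp
  · exact Or.inr (List.mem_map.2 ⟨k, List.mem_finRange k, rfl⟩)

variable (s s₁ t₁) in
/-- The letters, numbered in the order of `Letter.enum`. -/
def equivFin : Fin (enum s s₁ t₁).length ≃ Letter s s₁ t₁ :=
  List.Nodup.getEquivOfForallMemList _ nodup_enum mem_enum

theorem equivFin_apply (i) : equivFin s s₁ t₁ i = (enum s s₁ t₁).get i := rfl

/-- Exponents `b_j` of `x_j` correspond to exponents `b_j % 2` of `x_j` and `b_j / 2` of `z_j`. -/
def expEquiv (Q : ℕ → Prop) :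
    {E : (Fin s → ℕ) × (Fin t₁ → ℕ) // (∀ j : Fin s, (j : ℕ) < s₁ → E.1 j < 2) ∧
      (∀ j : Fin s, s₁ ≤ (j : ℕ) → Q (E.1 j / 2)) ∧ ∀ k, Q (E.2 k)} ≃
    {F : Letter s s₁ t₁ → ℕ // (∀ j, F (Sum.inl j) < 2) ∧ ∀ l, Q (F (Sum.inr l))} where
  toFun E := ⟨Sum.elim (fun j => E.1.1 j % 2) (Sum.elim (fun j => E.1.1 j / 2) E.1.2),
    fun j => Nat.mod_lt _ two_pos, by
      rintro (j | k)
      · exact E.2.2.1 j.1 j.2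
      · exact E.2.2.2 k⟩
  invFun F := ⟨(fun j => F.1 (Sum.inl j) +
      if h : s₁ ≤ (j : ℕ) then 2 * F.1 (Sum.inr (Sum.inl ⟨j, h⟩)) else 0,
      fun k => F.1 (Sum.inr (Sum.inr k))), by
    refine ⟨fun j hj => ?_, fun j hj => ?_, fun k => F.2.2 _⟩
    · simp only [dif_neg (not_le.2 hj)]
      exact F.2.1 j
    · simp only [dif_pos hj]
      rw [Nat.add_mul_div_left _ _ two_pos, Nat.div_eq_of_lt (F.2.1 j), zero_add]
      exact F.2.2 _⟩
  left_inv E := by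
    ext j
    · by_cases h : s₁ ≤ (j : ℕ)
      · simp [h, Nat.mod_add_div]
      · simpa [h] using E.2.1 j (not_le.1 h)
    · rfl
  right_inv F := by
    ext l
    rcases l with j | j | k
    · have := F.2.1 j
      by_cases h : s₁ ≤ (j : ℕ)
      · simp [h, Nat.mod_eq_of_lt this]
      · simp [h, Nat.mod_eq_of_lt this]
    · have := F.2.1 j.1
      simp [j.2, Nat.add_mul_div_left _ _ two_pos, Nat.div_eq_of_lt this]
    · rfl

/-- The exponents of the letters, as functions on numbers. -/
def indexEquiv (Q : ℕ → Prop) (par : Letter s s₁ t₁ → ZMod 2)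
    (hpar : ∀ j, par (Sum.inl j) = 1) (hpar' : ∀ l, par (Sum.inr l) = 0) :
    {F : Letter s s₁ t₁ → ℕ // (∀ j, F (Sum.inl j) < 2) ∧ ∀ l, Q (F (Sum.inr l))} ≃
    {E : Fin (enum s s₁ t₁).length → ℕ //
      (∀ i, par (equivFin s s₁ t₁ i) = 1 → E i < 2) ∧
        ∀ i, par (equivFin s s₁ t₁ i) = 0 → Q (E i)} :=
  Equiv.subtypeEquiv ((equivFin s s₁ t₁).symm.arrowCongr (Equiv.refl ℕ)) (by
    intro F
    simp only [Equiv.arrowCongr_apply, Equiv.coe_refl, Function.comp_apply, Equiv.symm_symm, id]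
    rw [(equivFin s s₁ t₁).forall_congr_left, (equivFin s s₁ t₁).forall_congr_left]
    simp [hpar, hpar'])

/-- Since z_j stands next to x_j, each j contributes a single factor, and merging their powers
requires no reordering. -/
theorem prod_map_enum {A : Type*} [Monoid A] (f : Letter s s₁ t₁ → A) :
    ((enum s s₁ t₁).map f).prod =
      ((List.finRange s).map fun j => f (Sum.inl j) *
        if h : s₁ ≤ (j : ℕ) then f (Sum.inr (Sum.inl ⟨j, h⟩)) else 1).prod *
      ((List.finRange t₁).map fun k => f (Sum.inr (Sum.inr k))).prod := by
  rw [enum, List.map_append, List.prod_append, List.map_flatten, List.prod_flatten, List.map_map,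
    List.map_map, List.map_map]
  congr 2
  refine List.map_congr_left fun j _ => ?_
  simp only [Function.comp_apply, block]
  split_ifs <;> simp

theorem orderedMonomial_equivFin {A : Type*} [Monoid A] (f : Letter s s₁ t₁ → A)
    (F : Letter s s₁ t₁ → ℕ) :
    orderedMonomial (fun i => f (equivFin s s₁ t₁ i)) (fun i => F (equivFin s s₁ t₁ i)) =
      ((enum s s₁ t₁).map fun l => f l ^ F l).prod := by
  rw [orderedMonomial]
  congr 1
  simp only [equivFin_apply]
  conv_rhs => rw [← List.ofFn_get (enum s s₁ t₁), List.map_ofFn]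
  rfl

/-- A basis of ordered monomials in all letters gives a basis of ordered monomials in the `x_j` and
the `y_k`, if the `z_j` are twice the squares of the `x_j`. -/
theorem exists_basis {κ A : Type*} [Field κ] [Ring A] [Algebra κ A] (h2 : (2 : κ) ≠ 0)
    (Q : ℕ → Prop) (par : Letter s s₁ t₁ → ZMod 2)
    (hpar : ∀ j, par (Sum.inl j) = 1) (hpar' : ∀ l, par (Sum.inr l) = 0)
    (f : Letter s s₁ t₁ → A)
    (hf : ∀ j : {j : Fin s // s₁ ≤ (j : ℕ)},
      f (Sum.inr (Sum.inl j)) = (2 : κ) • f (Sum.inl j.1) ^ 2)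
    (B : Module.Basis {E : Fin (enum s s₁ t₁).length → ℕ //
      (∀ i, par (equivFin s s₁ t₁ i) = 1 → E i < 2) ∧
        ∀ i, par (equivFin s s₁ t₁ i) = 0 → Q (E i)} κ A)
    (hB : ∀ E, B E = orderedMonomial (fun i => f (equivFin s s₁ t₁ i)) E.1) :
    ∃ B' : Module.Basis {E : (Fin s → ℕ) × (Fin t₁ → ℕ) //
        (∀ j : Fin s, (j : ℕ) < s₁ → E.1 j < 2) ∧
        (∀ j : Fin s, s₁ ≤ (j : ℕ) → Q (E.1 j / 2)) ∧ ∀ k, Q (E.2 k)} κ A,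
      ∀ E, B' E = orderedMonomial (fun j => f (Sum.inl j)) E.1.1 *
        orderedMonomial (fun k => f (Sum.inr (Sum.inr k))) E.1.2 := by
  let Ψ := (expEquiv (s := s) (s₁ := s₁) (t₁ := t₁) Q).trans (indexEquiv Q par hpar hpar')
  have key : ∀ E, ∃ c : κ, c ≠ 0 ∧ orderedMonomial (fun j => f (Sum.inl j)) E.1.1 *
      orderedMonomial (fun k => f (Sum.inr (Sum.inr k))) E.1.2 = c • B (Ψ E) := by
    intro E
    have hE : B (Ψ E) = ((enum s s₁ t₁).map fun l => f l ^ (expEquiv Q E).1 l).prod := by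
      rw [hB, ← orderedMonomial_equivFin]
      rfl
    rw [hE, prod_map_enum, orderedMonomial, orderedMonomial, List.ofFn_eq_map, List.ofFn_eq_map]
    obtain ⟨c, hc, h⟩ := List.exists_smul_prod_map (κ := κ) (List.finRange s)
      (a := fun j => f (Sum.inl j) ^ E.1.1 j)
      (b := fun j => f (Sum.inl j) ^ (expEquiv Q E).1 (Sum.inl j) *
        if h : s₁ ≤ (j : ℕ) then f (Sum.inr (Sum.inl ⟨j, h⟩)) ^
          (expEquiv Q E).1 (Sum.inr (Sum.inl ⟨j, h⟩)) else 1) (by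
        intro j
        change ∃ c : κ, c ≠ 0 ∧ f (Sum.inl j) ^ E.1.1 j = c • (f (Sum.inl j) ^ (E.1.1 j % 2) *
          if h : s₁ ≤ (j : ℕ) then f (Sum.inr (Sum.inl ⟨j, h⟩)) ^ (E.1.1 j / 2) else 1)
        split_ifs with h
        -- Each of the b / 2 copies of z_j = 2 x_j² contributes a factor 2.
        · refine ⟨((2 : κ) ^ (E.1.1 j / 2))⁻¹, inv_ne_zero (pow_ne_zero _ h2), ?_⟩
          rw [eq_inv_smul_iff₀ (pow_ne_zero _ h2), hf ⟨j, h⟩, smul_pow, mul_smul_comm, ← pow_mul,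
            ← pow_add, Nat.mod_add_div]
        · refine ⟨1, one_ne_zero, ?_⟩
          rw [Nat.mod_eq_of_lt (E.2.1 j (not_le.1 h)), mul_one, one_smul])
    refine ⟨c, hc, ?_⟩
    rw [h, smul_mul_assoc]
    rfl
  choose c hc h using key
  refine ⟨(B.reindex Ψ.symm).isUnitSMul fun E => (hc E).isUnit, fun E => ?_⟩
  rw [Module.Basis.isUnitSMul_apply, h]
  simp

end Letter

/-! ### The basis of letters and the conclusion -/

namespace LieSuperalgebra

variable {κ : Type*} {g : Type*} [Field κ] [AddCommGroup g] [Module κ g]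
variable {L : LieSuperalgebra κ g}

/-- The sign for two odd elements is -1, so the relation reads a² = [a, a] - a². -/
theorem ιU_bracket_self {a : g} (ha : a ∈ L.grade 1) :
    L.ιU (L.bracket a a) = (2 : κ) • L.ιU a ^ 2 := by
  have := ιU_mul_ιU ha ha
  rw [koszulSign_one_one] at this
  replace this := this.trans (congrArg _ (neg_one_smul κ (L.ιU a * L.ιU a)))
  rw [← sub_eq_add_neg, eq_sub_iff_add_eq] at this
  rw [← this, two_smul, sq]

/-- The basis of a Lie superalgebra that consists of the letters. -/
theorem exists_letterBasis {s s₁ t₁ : ℕ} (x : Module.Basis (Fin s) κ (L.grade 1))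
    (hz : LinearIndependent κ
      (fun j : {j : Fin s // s₁ ≤ (j : ℕ)} => L.bracket (x j.1 : g) (x j.1 : g)))
    (W : Submodule κ g)
    (hWV : Disjoint W (Submodule.span κ (Set.range
      fun j : {j : Fin s // s₁ ≤ (j : ℕ)} => L.bracket (x j.1 : g) (x j.1 : g))))
    (hWV' : W ⊔ Submodule.span κ (Set.range
      fun j : {j : Fin s // s₁ ≤ (j : ℕ)} => L.bracket (x j.1 : g) (x j.1 : g)) = L.grade 0)
    (y : Module.Basis (Fin t₁) κ W) :
    ∃ b : Module.Basis (Letter s s₁ t₁) κ g,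
      (∀ j, b (Sum.inl j) = x j) ∧
      (∀ j, b (Sum.inr (Sum.inl j)) = L.bracket (x j.1 : g) (x j.1 : g)) ∧
      ∀ k, b (Sum.inr (Sum.inr k)) = y k := by
  have hspan : ∀ {N : Submodule κ g} {m : ℕ} (b : Module.Basis (Fin m) κ N),
      Submodule.span κ (Set.range fun i => (b i : g)) = N := by
    intro N m b
    have : (fun i => (b i : g)) = N.subtype ∘ b := rfl
    rw [this, Set.range_comp, ← Submodule.map_span, b.span_eq, Submodule.map_subtype_top]
  have hli : ∀ {N : Submodule κ g} {m : ℕ} (b : Module.Basis (Fin m) κ N),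
      LinearIndependent κ fun i => (b i : g) := fun b =>
    b.linearIndependent.map' _ (Submodule.ker_subtype _)
  have h0 : LinearIndependent κ (Sum.elim
      (fun j : {j : Fin s // s₁ ≤ (j : ℕ)} => L.bracket (x j.1 : g) (x j.1 : g))
      fun k => (y k : g)) := by
    refine hz.sum_type (hli y) ?_
    rw [hspan y]
    exact hWV.symm
  have h0' : Submodule.span κ (Set.range (Sum.elim
      (fun j : {j : Fin s // s₁ ≤ (j : ℕ)} => L.bracket (x j.1 : g) (x j.1 : g))
      fun k => (y k : g))) = L.grade 0 := by
    rw [Set.Sum.elim_range, Submodule.span_union, hspan y, sup_comm, hWV']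
  have hl : LinearIndependent κ (Sum.elim (fun j => (x j : g)) (Sum.elim
      (fun j : {j : Fin s // s₁ ≤ (j : ℕ)} => L.bracket (x j.1 : g) (x j.1 : g))
      fun k => (y k : g))) := by
    refine (hli x).sum_type h0 ?_
    rw [hspan x, h0']
    exact L.isInternal.submodule_iSupIndep.pairwiseDisjoint (by decide)
  have hs : ⊤ ≤ Submodule.span κ (Set.range (Sum.elim (fun j => (x j : g)) (Sum.elim
      (fun j : {j : Fin s // s₁ ≤ (j : ℕ)} => L.bracket (x j.1 : g) (x j.1 : g))
      fun k => (y k : g)))) := by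
    rw [Set.Sum.elim_range, Submodule.span_union, hspan x, h0',
      ← L.isInternal.submodule_iSup_eq_top]
    refine iSup_le fun i => ?_
    rcases parity_cases i with rfl | rfl
    · exact le_sup_right
    · exact le_sup_left
  exact ⟨Module.Basis.mk hl hs, fun j => by simp, fun j => by simp, fun k => by simp⟩

end LieSuperalgebra

theorem proposition2p5 {κ : Type*} {g : Type*} [Field κ] [IsAlgClosed κ]
    (p : ℕ) [CharP κ p] (hp : 3 < p) [AddCommGroup g] [Module κ g]
    (L : LieSuperalgebra κ g) (s s₁ t₁ : ℕ) (hs : s₁ ≤ s)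
    (x : Module.Basis (Fin s) κ (L.grade 1))
    (hx₀ : ∀ i : Fin s, (i : ℕ) < s₁ → L.bracket (x i : g) (x i : g) = 0)
    (hx₁ : ∀ j : Fin s, s₁ ≤ (j : ℕ) → L.bracket (x j : g) (x j : g) ≠ 0)
    (hz : LinearIndependent κ
      (fun j : {j : Fin s // s₁ ≤ (j : ℕ)} => L.bracket (x j.1 : g) (x j.1 : g)))
    (V : Submodule κ g)
    (hV : V = Submodule.span κ
      (Set.range fun j : {j : Fin s // s₁ ≤ (j : ℕ)} => L.bracket (x j.1 : g) (x j.1 : g)))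
    (W : Submodule κ g) (hWV : Disjoint W V) (hWV' : W ⊔ V = L.grade 0)
    (y : Module.Basis (Fin t₁) κ W) :
    (∃ B : Module.Basis
        {e : (Fin s → ℕ) × (Fin t₁ → ℕ) // ∀ i : Fin s, (i : ℕ) < s₁ → e.1 i < 2} κ L.UEnv,
      ∀ e, B e = orderedMonomial (fun i => L.ιU (x i : g)) e.1.1 *
        orderedMonomial (fun k => L.ιU (y k : g)) e.1.2) ∧
    (∀ pm : L.grade 0 → L.grade 0, L.IsPMap p pm →
      ∃ B : Module.Basis
        {e : (Fin s → ℕ) × (Fin t₁ → ℕ) // (∀ i : Fin s, (i : ℕ) < s₁ → e.1 i < 2) ∧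
          (∀ j : Fin s, s₁ ≤ (j : ℕ) → e.1 j < 2 * p) ∧ (∀ k : Fin t₁, e.2 k < p)}
        κ (L.REnv p pm),
      ∀ e, B e = orderedMonomial (fun i => L.ιR p pm (x i : g)) e.1.1 *
        orderedMonomial (fun k => L.ιR p pm (y k : g)) e.1.2) := by
  classical
  subst hV
  have hprime : p.Prime := (CharP.char_is_prime_or_zero κ p).resolve_right (by omega)
  have hne : ∀ m : ℕ, 0 < m → m < p → (m : κ) ≠ 0 := fun m h0 hm h =>
    Nat.not_dvd_of_pos_of_lt h0 hm ((CharP.cast_eq_zero_iff κ p m).1 h)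
  have h2 : (2 : κ) ≠ 0 := by exact_mod_cast hne 2 (by omega) (by omega)
  have h3 : (3 : κ) ≠ 0 := by exact_mod_cast hne 3 (by omega) hp
  obtain ⟨b, hbx, hbz, hby⟩ := LieSuperalgebra.exists_letterBasis x hz W hWV hWV' y
  let par : Letter s s₁ t₁ → ZMod 2 := Sum.elim (fun _ => 1) fun _ => 0
  have hb : ∀ l, b l ∈ L.grade (par l) := by
    rintro (j | j | k)
    · rw [hbx]
      exact (x j).2
    · rw [hbz]
      exact L.bracket_mem 1 1 _ _ (x j.1).2 (x j.1).2
    · rw [hby]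
      have : (y k : g) ∈ L.grade 0 := hWV' ▸ Submodule.mem_sup_left (y k).2
      exact this
  let e := b.reindex (Letter.equivFin s s₁ t₁).symm
  have he' : ∀ i, e i = b (Letter.equivFin s s₁ t₁ i) := fun i => by simp [e]
  have he : ∀ i, e i ∈ L.grade (par (Letter.equivFin s s₁ t₁ i)) := fun i => by
    rw [he']
    exact hb _
  constructor
  · obtain ⟨B, hB⟩ := LieSuperalgebra.exists_pbwBasis h2 h3 he
    -- In U(g) the even letters have unbounded exponents, so `Q` is trivial.
    obtain ⟨B', hB'⟩ := Letter.exists_basis h2 (fun _ => True) par (fun _ => rfl) (fun _ => rfl)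
      (fun l => L.ιU (b l)) (fun j => by
        rw [hbz, hbx]
        exact LieSuperalgebra.ιU_bracket_self (x j.1).2)
      (B.reindex (Equiv.subtypeEquivRight fun E => by simp))
      (fun E => by
        rw [Module.Basis.reindex_apply, hB]
        simp only [he']
        rfl)
    refine ⟨B'.reindex (Equiv.subtypeEquivRight fun E => by simp), fun E => ?_⟩
    rw [Module.Basis.reindex_apply, hB']
    simp only [hbx, hby]
    rfl
  · intro pm hpm
    obtain ⟨B, hB⟩ := LieSuperalgebra.exists_restrictedPbwBasis hprime hp h2 h3 hpm he
    -- Here `Q` bounds the exponents of z_j and y_k by `p`; b / 2 < p is the bound b < 2p.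
    obtain ⟨B', hB'⟩ := Letter.exists_basis h2 (fun m => m < p) par (fun _ => rfl) (fun _ => rfl)
      (fun l => L.ιR p pm (b l)) (fun j => by
        rw [hbz, hbx]
        have := congrArg (RingQuot.mkAlgHom κ (L.RRel p pm))
          (LieSuperalgebra.ιU_bracket_self (x j.1).2)
        rw [map_smul, map_pow] at this
        exact this)
      B (fun E => by
        rw [hB]
        simp only [he'])
    refine ⟨B'.reindex (Equiv.subtypeEquivRight fun E => by
      simp only [Nat.div_lt_iff_lt_mul two_pos, mul_comm p 2]), fun E => ?_⟩
    rw [Module.Basis.reindex_apply, hB']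
    simp only [hbx, hby]
    rfl
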